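/- Let $\mathcal S,\mathcal A,\mathcal D$ be finite sets with $|\mathcal S|=S$, $|\mathcal A|=A$, $|\mathcal D|=d$, let $H$ be the horizon, $s_0\in\mathcal S$ the initial state and $\xi(i)$, $i\in\mathcal D$, the capacities. The true constrained MDP $(p^\star,r^\star,\boldsymbol c^\star)$ has transition probabilities $p^\star(\cdot\mid s,a)$, mean rewards $r^\star(s,a)\in[0,1]$ and mean consumptions $c^\star(s,a,i)\in[0,1]$. A policy $\pi=(\pi_h)_{h=1}^H$ selects at step $h$ in state $s$ an action from the distribution $\pi_h(\cdot\mid s)$, and for an objective $m$ we write $\mathbb E^{\pi,p}\big[\sum_{h=1}^H m(s_h,a_h)\big]$ for the expectation over a run of $\pi$ from $s_1=s_0$ with transitions $p$; if a row $p(\cdot\mid s,a)$ is zero, the run ends after $(s,a)$. Let $\pi^\star$ maximize $\mathbb E^{\pi,p^\star}\big[\sum_h r^\star(s_h,a_h)\big]$ over the policies $\pi$ with $\mathbb E^{\pi,p^\star}\big[\sum_h c^\star(s_h,a_h,i)\big]\le\xi(i)$ for all $i$ (this program is assumed to be feasible). In episode $k=1,2,\dots$ the learner commits to a policy $\pi_k$,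 depending on the previous episodes, and starts from $s_{k,1}=s_0$; for $h=1,\dots,H$, given the past, $a_{k,h}\sim\pi_{k,h}(\cdot\mid s_{k,h})$, and given also $a_{k,h}$, the reward $r_{k,h}\in[0,1]$ and the (possibly correlated) consumptions $c_{k,h,i}\in[0,1]$ have means $r^\star(s_{k,h},a_{k,h})$ and $c^\star(s_{k,h},a_{k,h},i)$, and $s_{k,h+1}\sim p^\star(\cdot\mid s_{k,h},a_{k,h})$. Let $$N_k(s,a)=\max\Big\{1,\sum_{t<k}\sum_{h=1}^H\mathbf 1\{s_{t,h}=s,a_{t,h}=a\}\Big\},$$ let $\hat p_k(s'\mid s,a)$, $\hat r_k(s,a)$, $\hat c_k(s,a,i)$ be $1/N_k(s,a)$ times the sums over $t<k$ and $h\in[H]$ of $\mathbf 1\{s_{t,h}=s,a_{t,h}=a,s_{t,h+1}=s'\}$, of $r_{t,h}\mathbf 1\{s_{t,h}=s,a_{t,h}=a\}$ and of $c_{t,h,i}\mathbf 1\{s_{t,h}=s,a_{t,h}=a\}$ respectively, and for $\delta>0$ let $$\hat b_k(s,a)=\min\Big\{2H,\;H\sqrt{\tfrac{2\ln(8SAH(d+1)k^2/\delta)}{N_k(s,a)}}\Big\}.$$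 ConRL (with an exact planner) takes for $\pi_k$ a policy that maximizes $\mathbb E^{\pi,\hat p_k}\big[\sum_h(\hat r_k+\hat b_k)(s_h,a_h)\big]$ over the policies $\pi$ with $\mathbb E^{\pi,\hat p_k}\big[\sum_h(\hat c_k(s_h,a_h,i)-\hat b_k(s_h,a_h))\big]\le\xi(i)$ for all $i\in\mathcal D$ (and an arbitrary policy if there is no such $\pi$). Put $$\mathrm{RewReg}(k)=\mathbb E^{\pi^\star,p^\star}\Big[\sum_{h=1}^H r^\star(s_h,a_h)\Big]-\frac1k\sum_{t=1}^k\mathbb E^{\pi_t,p^\star}\Big[\sum_{h=1}^H r^\star(s_h,a_h)\Big],$$ $$\mathrm{ConsReg}(k)=\max_{i\in\mathcal D}\Big(\frac1k\sum_{t=1}^k\mathbb E^{\pi_t,p^\star}\Big[\sum_{h=1}^H c^\star(s_h,a_h,i)\Big]-\xi(i)\Big).$$ Theorem. There is an absolute constant $c>0$ such that in every such situation, with probability at least $1-3\delta$, simultaneously for all $k\ge1$, both $\mathrm{RewReg}(k)$ and $\mathrm{ConsReg}(k)$ are at most $$\frac{c}{\sqrt k}\,H^{2.5}S\sqrt A\,\sqrt{\ln(k)\,\ln\big(SAH(d+1)k/\delta\big)}+\frac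 ck\,S^{3/2}AH^3\sqrt{\ln\big(2SAH(d+1)k/\delta\big)}.$$ -/

import Mathlib

open MeasureTheory

/-- The numerical data `(p, r, c)` of a constrained MDP: `p s a s'` is the transition weight from
`(s, a)` to `s'`, `r s a` the (mean) reward and `c s a i` the (mean) consumption of resource `i`.
The estimated models of the learner are of this type too; their rewards and consumptions may leave
`[0, 1]`, and their transition rows may vanish. -/
structure CMDP (S A ι : Type*) where
  p : S → A → S → ℝ
  r : S → A → ℝ
  c : S → A → ι → ℝ

/-- A genuine constrained MDP: the transitions are probability vectors, and mean rewards and mean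
consumptions lie in `[0, 1]`. -/
structure CMDP.IsProper {S A ι : Type*} [Fintype S] (M : CMDP S A ι) : Prop where
  p_mem : ∀ s a, M.p s a ∈ stdSimplex ℝ S
  r_mem : ∀ s a, M.r s a ∈ Set.Icc (0 : ℝ) 1
  c_mem : ∀ s a i, M.c s a i ∈ Set.Icc (0 : ℝ) 1

/-- A randomized, step-dependent policy: at step `h` in state `s`, action `a` is selected with
probability `π h s a`. The steps of an episode are numbered `0, …, H - 1`. -/
abbrev Policy (S A : Type*) : Type _ := ℕ → S → A → ℝ

/-- `π` selects actions by a probability vector, in every state and at every step of an episode. -/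
def IsPolicy {S A : Type*} [Fintype A] (H : ℕ) (π : Policy S A) : Prop :=
  ∀ h < H, ∀ s, π h s ∈ stdSimplex ℝ A

section Planning

variable {S A ι : Type*} [Fintype S] [DecidableEq S] [Fintype A]

/-- The law of the state at step `h` when `π` is run from `s₀` with transitions `p`. (If a row
`p s a` is identically zero, the run ends after `a` is selected in `s`.) -/
def stateProb (s₀ : S) (π : Policy S A) (p : S → A → S → ℝ) : ℕ → S → ℝ
  | 0, s => if s = s₀ then 1 else 0
  | h + 1, s' => ∑ s, ∑ a, stateProb s₀ π p h s * π h s a * p s a s'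

/-- The expectation of `∑ h, m (s_h, a_h)` over one episode of length `H`, run from `s₀` under the
policy `π` and the transitions `p`. -/
def expTotal (H : ℕ) (s₀ : S) (π : Policy S A) (p : S → A → S → ℝ) (m : S → A → ℝ) : ℝ :=
  ∑ h ∈ Finset.range H, ∑ s, ∑ a, stateProb s₀ π p h s * π h s a * m s a

/-- `π` is a policy whose expected consumptions in the model `M` respect the capacities `ξ`. -/
def IsFeasible (H : ℕ) (s₀ : S) (ξ : ι → ℝ) (M : CMDP S A ι) (π : Policy S A) : Prop :=
  IsPolicy H π ∧ ∀ i, expTotal H s₀ π M.p (fun s a => M.c s a i) ≤ ξ i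

/-- `π` maximizes the expected reward in the model `M` among all feasible policies. -/
def IsOptimal (H : ℕ) (s₀ : S) (ξ : ι → ℝ) (M : CMDP S A ι) (π : Policy S A) : Prop :=
  IsFeasible H s₀ ξ M π ∧
    ∀ π', IsFeasible H s₀ ξ M π' → expTotal H s₀ π' M.p M.r ≤ expTotal H s₀ π M.p M.r

end Planning

/-- The random observations of the learner. Episodes are numbered `1, 2, …`; in episode `k`,
`state k h` is defined for `h = 0, …, H`, the others for the steps `h = 0, …, H - 1`. -/
structure Observations (S A ι Ω : Type*) where
  state : ℕ → ℕ → Ω → S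
  action : ℕ → ℕ → Ω → A
  reward : ℕ → ℕ → Ω → ℝ
  consumption : ℕ → ℕ → ι → Ω → ℝ

/-- The time just before the action at step `h` of episode `k` is selected, when the state at step
`h` is known. Note that `preTime H k H = preTime H (k + 1) 0`. -/
def preTime (H k h : ℕ) : ℕ := 2 * (k * H + h)

/-- The time just after the action at step `h` of episode `k` is selected, before its outcome. -/
def postTime (H k h : ℕ) : ℕ := 2 * (k * H + h) + 1

section Protocol

variable {S A ι Ω : Type*} [Fintype S] [DecidableEq S] [Fintype A] [DecidableEq A]

/-- The episodic protocol in the environment `M`, with respect to the flow of information `ℱ`: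
the (random) policy `π k` is committed to before episode `k` starts from `s₀`; given the past, the
action at step `h` has law `π k h (state k h)`; given the past and the action, the next state has
law `M.p s a`, and the reward and the consumptions, which take values in `[0, 1]` and may be
correlated, have means `M.r s a` and `M.c s a`, where `(s, a)` is the current state-action pair. -/
structure FollowsProtocol {mΩ : MeasurableSpace Ω} (μ : Measure Ω) (ℱ : Filtration ℕ mΩ)
    (H : ℕ) (s₀ : S) (M : CMDP S A ι) (π : ℕ → Ω → Policy S A)
    (O : Observations S A ι Ω) : Prop where
  isPolicy : ∀ k, 1 ≤ k → ∀ ω, IsPolicy H (π k ω)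
  measurable_policy : ∀ k, 1 ≤ k → ∀ h < H, ∀ s a,
    Measurable[ℱ (preTime H k 0)] (fun ω => π k ω h s a)
  measurable_state : ∀ k, 1 ≤ k → ∀ h ≤ H, ∀ s,
    MeasurableSet[ℱ (preTime H k h)] {ω | O.state k h ω = s}
  measurable_action : ∀ k, 1 ≤ k → ∀ h < H, ∀ a,
    MeasurableSet[ℱ (postTime H k h)] {ω | O.action k h ω = a}
  measurable_reward : ∀ k, 1 ≤ k → ∀ h < H,
    Measurable[ℱ (preTime H k (h + 1))] (O.reward k h)
  measurable_consumption : ∀ k, 1 ≤ k → ∀ h < H, ∀ i,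
    Measurable[ℱ (preTime H k (h + 1))] (O.consumption k h i)
  reward_mem : ∀ k, 1 ≤ k → ∀ h < H, ∀ᵐ ω ∂μ, O.reward k h ω ∈ Set.Icc (0 : ℝ) 1
  consumption_mem : ∀ k, 1 ≤ k → ∀ h < H, ∀ i,
    ∀ᵐ ω ∂μ, O.consumption k h i ω ∈ Set.Icc (0 : ℝ) 1
  state_zero : ∀ k, 1 ≤ k → ∀ ω, O.state k 0 ω = s₀
  action_law : ∀ k, 1 ≤ k → ∀ h < H, ∀ a,
    μ[fun ω => if O.action k h ω = a then (1 : ℝ) else 0 | ℱ (preTime H k h)]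
      =ᵐ[μ] fun ω => π k ω h (O.state k h ω) a
  state_law : ∀ k, 1 ≤ k → ∀ h < H, ∀ s',
    μ[fun ω => if O.state k (h + 1) ω = s' then (1 : ℝ) else 0 | ℱ (postTime H k h)]
      =ᵐ[μ] fun ω => M.p (O.state k h ω) (O.action k h ω) s'
  reward_mean : ∀ k, 1 ≤ k → ∀ h < H,
    μ[O.reward k h | ℱ (postTime H k h)]
      =ᵐ[μ] fun ω => M.r (O.state k h ω) (O.action k h ω)
  consumption_mean : ∀ k, 1 ≤ k → ∀ h < H, ∀ i,
    μ[O.consumption k h i | ℱ (postTime H k h)]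
      =ᵐ[μ] fun ω => M.c (O.state k h ω) (O.action k h ω) i

end Protocol

noncomputable section Estimates

variable {S A ι Ω : Type*} [DecidableEq S] [DecidableEq A]

/-- The number of visits of `(s, a)` before episode `k`, replaced by `1` if there are none. -/
def visitCount (H : ℕ) (O : Observations S A ι Ω) (k : ℕ) (ω : Ω) (s : S) (a : A) : ℝ :=
  max 1 (∑ t ∈ Finset.Ico 1 k, ∑ h ∈ Finset.range H,
    if O.state t h ω = s ∧ O.action t h ω = a then 1 else 0)

/-- Empirical transition probabilities before episode `k`. -/
def empTransition (H : ℕ) (O : Observations S A ι Ω) (k : ℕ) (ω : Ω) (s : S) (a : A) (s' : S) :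
    ℝ :=
  (∑ t ∈ Finset.Ico 1 k, ∑ h ∈ Finset.range H,
    if O.state t h ω = s ∧ O.action t h ω = a ∧ O.state t (h + 1) ω = s' then 1 else 0) /
      visitCount H O k ω s a

/-- Empirical mean rewards before episode `k`. -/
def empReward (H : ℕ) (O : Observations S A ι Ω) (k : ℕ) (ω : Ω) (s : S) (a : A) : ℝ :=
  (∑ t ∈ Finset.Ico 1 k, ∑ h ∈ Finset.range H,
    if O.state t h ω = s ∧ O.action t h ω = a then O.reward t h ω else 0) /
      visitCount H O k ω s a

/-- Empirical mean consumptions before episode `k`. -/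
def empConsumption (H : ℕ) (O : Observations S A ι Ω) (k : ℕ) (ω : Ω) (s : S) (a : A) (i : ι) :
    ℝ :=
  (∑ t ∈ Finset.Ico 1 k, ∑ h ∈ Finset.range H,
    if O.state t h ω = s ∧ O.action t h ω = a then O.consumption t h i ω else 0) /
      visitCount H O k ω s a

/-- The clipped Hoeffding bonus of episode `k`. -/
def bonus [Fintype S] [Fintype A] [Fintype ι] (H : ℕ) (δ : ℝ) (O : Observations S A ι Ω)
    (k : ℕ) (ω : Ω) (s : S) (a : A) : ℝ :=
  min (2 * H) (H * √(2 * Real.log (8 * Fintype.card S * Fintype.card A * H *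
    (Fintype.card ι + 1) * (k : ℝ) ^ 2 / δ) / visitCount H O k ω s a))

/-- The bonus-enhanced model of episode `k`. -/
def bonusModel [Fintype S] [Fintype A] [Fintype ι] (H : ℕ) (δ : ℝ) (O : Observations S A ι Ω)
    (k : ℕ) (ω : Ω) : CMDP S A ι where
  p := empTransition H O k ω
  r s a := empReward H O k ω s a + bonus H δ O k ω s a
  c s a i := empConsumption H O k ω s a i - bonus H δ O k ω s a

/-- The policies are chosen by ConRL with an exact planner: `π k` maximizes the expected reward
subject to the expected-consumption constraints in the bonus-enhanced model of episode `k`. If that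
program has no feasible point, the planner may return any policy. -/
def ChosenByConRL [Fintype S] [Fintype A] [Fintype ι] (H : ℕ) (s₀ : S) (ξ : ι → ℝ) (δ : ℝ)
    (O : Observations S A ι Ω) (π : ℕ → Ω → Policy S A) : Prop :=
  ∀ k, 1 ≤ k → ∀ ω, (∃ π', IsFeasible H s₀ ξ (bonusModel H δ O k ω) π') →
    IsOptimal H s₀ ξ (bonusModel H δ O k ω) (π k ω)

end Estimates

noncomputable section Regret

variable {S A ι : Type*} [Fintype S] [DecidableEq S] [Fintype A]

/-- Reward regret of the policies `π 1, …, π k` against `πstar`. -/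
def rewReg (H : ℕ) (s₀ : S) (M : CMDP S A ι) (πstar : Policy S A) (π : ℕ → Policy S A) (k : ℕ) :
    ℝ :=
  expTotal H s₀ πstar M.p M.r - 1 / (k : ℝ) * ∑ t ∈ Finset.Icc 1 k, expTotal H s₀ (π t) M.p M.r

/-- Consumption regret of the policies `π 1, …, π k`: the largest excess over a capacity (`0` if
there are no resources). -/
def consReg (H : ℕ) (s₀ : S) (ξ : ι → ℝ) (M : CMDP S A ι) (π : ℕ → Policy S A) (k : ℕ) : ℝ :=
  ⨆ i, (1 / (k : ℝ) * ∑ t ∈ Finset.Icc 1 k, expTotal H s₀ (π t) M.p (fun s a => M.c s a i) - ξ i)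

end Regret

/-- The regret bound after `k` episodes, with numbers `S` of states, `A` of actions and `d` of
resources, horizon `H`, failure parameter `δ` and constant `c`. -/
noncomputable def regretBound (c : ℝ) (S A d H : ℕ) (δ : ℝ) (k : ℕ) : ℝ :=
  c / √k * (H : ℝ) ^ (5 / 2 : ℝ) * S * √A *
      √(Real.log k * Real.log (S * A * H * (d + 1) * k / δ)) +
    c / k * (S : ℝ) ^ (3 / 2 : ℝ) * A * (H : ℝ) ^ 3 *
      √(Real.log (2 * S * A * H * (d + 1) * k / δ))

/-! The proof is optimism in the face of uncertainty, with one bonus serving the reward and all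
constraints. Write `L` for the logarithm in the bonus, `N` for the visit count, and `u = min 1 √(10
S L / N)` for the uncertainty of a state-action pair.

Optimism. The value functions of `πstar` in the true model do not depend on the data, so Hoeffding's
inequality compares empirical and true one-step expectations of "outcome plus value of the next
state" up to `H √(2 L / N)`, with no factor `S` (`measure_abs_bellman_error_ge_le`). This is the
bonus. Adding it to rewards and subtracting it from consumptions makes every one-step comparison
with the true values of `πstar` favourable. Hence `πstar` is feasible for the planner, and the
planned policy earns, in the bonus-enhanced model, at least the true optimum while respecting the
capacities there (`chosen_policy_optimistic`).

Simulation. Both regrets of an episode are therefore at most the gap between the totals of the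
planned policy in the true and in the bonus-enhanced model. By the simulation lemma this gap is a
sum of one-step model differences along the true process. The planned policy depends on the data, so
the transition error is measured in total variation, at the price of a union bound over `2 ^ S` sign
patterns. Clipping the bonus keeps the values in the enhanced model below `3 H ^ 2`, and the gap is
at most `10 H ^ 2` times the expected total of `u` (`abs_expTotal_sub_bonusModel_le`).

Summation. Expected totals of `u` are at most twice the realized ones plus `2 H L`, by a
multiplicative supermartingale bound; an additive Azuma bound would instead leave a deviation of
order `H √(k L)`. Realized totals are controlled by a pigeonhole argument on `∑ 1 / √N` and by
Cauchy–Schwarz over the `S A` pairs (`sum_uncertainty_le`). This yields the terms `H ^ 2.5 S √(A k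
L)`, `S ^ 1.5 A H ^ 3 √L` and `H ^ 3 L`; the last is absorbed by comparison with the trivial bound
`k H` on the cumulative regret (`div_le_regretBound`).

All concentration bounds come from the one-step condition `IsExpContraction`, chained along the
filtration and finished by Markov's inequality. -/

/-! ### Value functions and the simulation lemma. -/

section Planning

variable {S A : Type*} [Fintype S] [Fintype A]

/-- The expected total of `m` over the last `n` steps of an episode of length `H`. -/
def valueToGo (H : ℕ) (π : Policy S A) (p : S → A → S → ℝ) (m : S → A → ℝ) : ℕ → S → ℝ
  | 0, _ => 0
  | n + 1, s => ∑ a, π (H - (n + 1)) s a * (m s a + ∑ s', p s a s' * valueToGo H π p m n s')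

/-- The value function: the expected total of `m` over the steps `h, …, H - 1`. -/
def valueFn (H : ℕ) (π : Policy S A) (p : S → A → S → ℝ) (m : S → A → ℝ) (h : ℕ) (s : S) : ℝ :=
  valueToGo H π p m (H - h) s

theorem valueFn_horizon (H : ℕ) (π : Policy S A) (p : S → A → S → ℝ) (m : S → A → ℝ) (s : S) :
    valueFn H π p m H s = 0 := by
  simp [valueFn, valueToGo]

theorem valueFn_of_lt {H h : ℕ} (hh : h < H) (π : Policy S A) (p : S → A → S → ℝ)
    (m : S → A → ℝ) (s : S) :
    valueFn H π p m h s =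
      ∑ a, π h s a * (m s a + ∑ s', p s a s' * valueFn H π p m (h + 1) s') := by
  obtain ⟨n, rfl⟩ : ∃ n, H = h + 1 + n := ⟨H - (h + 1), by omega⟩
  have h1 : h + 1 + n - h = n + 1 := by omega
  have h2 : h + 1 + n - (h + 1) = n := by omega
  have h3 : h + 1 + n - (n + 1) = h := by omega
  simp only [valueFn, h1, h2, valueToGo, h3]

/-- Averages of numbers in `[lo, hi]` over a probability vector stay in `[lo, hi]`. -/
theorem sum_mul_mem_Icc_of_mem_stdSimplex {X : Type*} [Fintype X] {w f : X → ℝ} {lo hi : ℝ}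
    (hw : w ∈ stdSimplex ℝ X) (hf : ∀ x, f x ∈ Set.Icc lo hi) :
    ∑ x, w x * f x ∈ Set.Icc lo hi := by
  constructor
  · calc lo = ∑ x, w x * lo := by rw [← Finset.sum_mul, hw.2, one_mul]
      _ ≤ _ := Finset.sum_le_sum fun x _ => mul_le_mul_of_nonneg_left (hf x).1 (hw.1 x)
  · calc ∑ x, w x * f x ≤ ∑ x, w x * hi :=
        Finset.sum_le_sum fun x _ => mul_le_mul_of_nonneg_left (hf x).2 (hw.1 x)
      _ = hi := by rw [← Finset.sum_mul, hw.2, one_mul]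

theorem abs_sum_mul_le_of_sum_le_one {X : Type*} [Fintype X] {w f : X → ℝ} {b : ℝ}
    (hw : ∀ x, 0 ≤ w x) (hw1 : ∑ x, w x ≤ 1) (hb : 0 ≤ b) (hf : ∀ x, |f x| ≤ b) :
    |∑ x, w x * f x| ≤ b := by
  calc |∑ x, w x * f x| ≤ ∑ x, |w x * f x| := Finset.abs_sum_le_sum_abs _ _
    _ ≤ ∑ x, w x * b := Finset.sum_le_sum fun x _ => by
        rw [abs_mul, abs_of_nonneg (hw x)]
        exact mul_le_mul_of_nonneg_left (hf x) (hw x)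
    _ = (∑ x, w x) * b := by rw [Finset.sum_mul]
    _ ≤ 1 * b := mul_le_mul_of_nonneg_right hw1 hb
    _ = b := one_mul b

/-- Signed objectives and rows of mass below one are allowed, because the bound is applied to the
learner's models. -/
theorem abs_valueFn_le {H : ℕ} {π : Policy S A} (hπ : IsPolicy H π) {p : S → A → S → ℝ}
    (hp : ∀ s a s', 0 ≤ p s a s') (hp1 : ∀ s a, ∑ s', p s a s' ≤ 1) {m : S → A → ℝ} {b : ℝ}
    (hb : 0 ≤ b) (hm : ∀ s a, |m s a| ≤ b) {h : ℕ} (hh : h ≤ H) (s : S) :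
    |valueFn H π p m h s| ≤ ((H - h : ℕ) : ℝ) * b := by
  induction hh using Nat.decreasingInduction generalizing s with
  | self => simp [valueFn_horizon]
  | of_succ h hh ih =>
    have e : H - h = (H - (h + 1)) + 1 := by omega
    rw [valueFn_of_lt hh, e]
    push_cast
    refine abs_sum_mul_le_of_sum_le_one (hπ h hh s).1 (hπ h hh s).2.le (by positivity) fun a => ?_
    have := abs_sum_mul_le_of_sum_le_one (hp s a) (hp1 s a) (by positivity) ih
    calc _ ≤ |m s a| + |∑ s', p s a s' * valueFn H π p m (h + 1) s'| := abs_add_le _ _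
      _ ≤ _ := by linarith [hm s a]

theorem valueFn_mem_Icc {H : ℕ} {π : Policy S A} (hπ : IsPolicy H π) {p : S → A → S → ℝ}
    (hp : ∀ s a, p s a ∈ stdSimplex ℝ S) {m : S → A → ℝ}
    (hm : ∀ s a, m s a ∈ Set.Icc (0 : ℝ) 1) {h : ℕ} (hh : h ≤ H) (s : S) :
    valueFn H π p m h s ∈ Set.Icc (0 : ℝ) ((H - h : ℕ) : ℝ) := by
  induction hh using Nat.decreasingInduction generalizing s with
  | self => simp [valueFn_horizon]
  | of_succ h hh ih =>
    have e : H - h = (H - (h + 1)) + 1 := by omega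
    rw [valueFn_of_lt hh, e]
    push_cast
    refine sum_mul_mem_Icc_of_mem_stdSimplex (hπ h hh s) fun a => ?_
    have h1 := sum_mul_mem_Icc_of_mem_stdSimplex (hp s a) ih
    have h2 := hm s a
    exact ⟨by linarith [h1.1, h2.1], by linarith [h1.2, h2.2]⟩

variable [DecidableEq S]

theorem stateProb_nonneg {H : ℕ} {s₀ : S} {π : Policy S A} (hπ : IsPolicy H π)
    {p : S → A → S → ℝ} (hp : ∀ s a s', 0 ≤ p s a s') {h : ℕ} (hh : h ≤ H) (s : S) :
    0 ≤ stateProb s₀ π p h s := by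
  induction h generalizing s with
  | zero => simp only [stateProb]; split_ifs <;> norm_num
  | succ h ih =>
    simp only [stateProb]
    exact Finset.sum_nonneg fun x _ => Finset.sum_nonneg fun a _ =>
      mul_nonneg (mul_nonneg (ih (by omega) x) ((hπ h (by omega) x).1 a)) (hp _ _ _)

theorem sum_stateProb {H : ℕ} {s₀ : S} {π : Policy S A} (hπ : IsPolicy H π)
    {p : S → A → S → ℝ} (hp : ∀ s a, p s a ∈ stdSimplex ℝ S) {h : ℕ} (hh : h ≤ H) :
    ∑ s, stateProb s₀ π p h s = 1 := by
  induction h with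
  | zero => simp [stateProb]
  | succ h ih =>
    simp only [stateProb]
    rw [Finset.sum_comm, ← ih (by omega)]
    refine Finset.sum_congr rfl fun s _ => ?_
    rw [Finset.sum_comm]
    simp_rw [← Finset.mul_sum, (hp s _).2, mul_one, ← Finset.mul_sum]
    rw [(hπ h (by omega) s).2, mul_one]

/-- Pushing the state law one step forward is dual to averaging a function over the next state. This
duality makes the simulation lemma telescope. -/
theorem sum_stateProb_mul_succ (s₀ : S) (π : Policy S A) (p : S → A → S → ℝ) (h : ℕ)
    (U : S → ℝ) :
    ∑ s, stateProb s₀ π p (h + 1) s * U s =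
      ∑ s, ∑ a, stateProb s₀ π p h s * π h s a * ∑ s', p s a s' * U s' := by
  simp only [stateProb, Finset.sum_mul]
  rw [Finset.sum_comm]
  refine Finset.sum_congr rfl fun s _ => ?_
  rw [Finset.sum_comm]
  refine Finset.sum_congr rfl fun a _ => ?_
  rw [Finset.mul_sum]
  exact Finset.sum_congr rfl fun s' _ => by ring

/-- The simulation lemma: the difference of the totals of a policy in two models, expressed by the
one-step differences of the models, along the first model. -/
theorem expTotal_sub_expTotal (H : ℕ) (s₀ : S) (π : Policy S A) (p₁ p₂ : S → A → S → ℝ)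
    (m₁ m₂ : S → A → ℝ) :
    expTotal H s₀ π p₁ m₁ - valueFn H π p₂ m₂ 0 s₀ =
      ∑ h ∈ Finset.range H, ∑ s, ∑ a, stateProb s₀ π p₁ h s * π h s a *
        (m₁ s a - m₂ s a + ∑ s', (p₁ s a s' - p₂ s a s') * valueFn H π p₂ m₂ (h + 1) s') := by
  set V := valueFn H π p₂ m₂ with hV
  -- The value function of the second model is followed along the first process; each step costs the
  -- defect of its Bellman equation. At `n = H` the left side vanishes.
  have key : ∀ n ≤ H, ∑ s, stateProb s₀ π p₁ n s * V n s =
      V 0 s₀ - ∑ h ∈ Finset.range n, ∑ s, ∑ a, stateProb s₀ π p₁ h s * π h s a *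
        (m₂ s a + ∑ s', (p₂ s a s' - p₁ s a s') * V (h + 1) s') := by
    intro n
    induction n with
    | zero => intro _; simp [stateProb]
    | succ n ih =>
      intro hn
      have h1 := ih (by omega)
      rw [Finset.sum_range_succ, ← sub_sub, ← h1, sum_stateProb_mul_succ, ← Finset.sum_sub_distrib]
      refine Finset.sum_congr rfl fun s _ => ?_
      rw [hV, valueFn_of_lt (by omega : n < H), ← hV, Finset.mul_sum, ← Finset.sum_sub_distrib]
      refine Finset.sum_congr rfl fun a _ => ?_
      simp only [sub_mul, Finset.sum_sub_distrib]
      ring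
  have hH := key H le_rfl
  have hz : ∑ s, stateProb s₀ π p₁ H s * V H s = 0 := by simp [hV, valueFn_horizon]
  rw [hz] at hH
  have hV0 : V 0 s₀ = _ := (sub_eq_zero.mp hH.symm)
  rw [hV0, expTotal, ← Finset.sum_sub_distrib]
  refine Finset.sum_congr rfl fun h _ => ?_
  rw [← Finset.sum_sub_distrib]
  refine Finset.sum_congr rfl fun s _ => ?_
  rw [← Finset.sum_sub_distrib]
  refine Finset.sum_congr rfl fun a _ => ?_
  simp only [sub_mul, Finset.sum_sub_distrib]
  ring

/-- Against itself a model has no one-step differences, so the simulation lemma reconciles the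
forward definition of the total with the backward recursion. -/
theorem expTotal_eq_valueFn (H : ℕ) (s₀ : S) (π : Policy S A) (p : S → A → S → ℝ)
    (m : S → A → ℝ) : expTotal H s₀ π p m = valueFn H π p m 0 s₀ := by
  have := expTotal_sub_expTotal H s₀ π p p m m
  simpa [sub_eq_zero] using this

/-- A policy has the larger total in the first model if its one-step comparison with the value
function of the second model is favourable. -/
theorem expTotal_le_expTotal_of_step {H : ℕ} {s₀ : S} {π : Policy S A} (hπ : IsPolicy H π)
    {p₁ p₂ : S → A → S → ℝ} {m₁ m₂ : S → A → ℝ} (hp : ∀ s a s', 0 ≤ p₁ s a s')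
    (hstep : ∀ h < H, ∀ s a,
      0 ≤ m₁ s a - m₂ s a + ∑ s', (p₁ s a s' - p₂ s a s') * valueFn H π p₂ m₂ (h + 1) s') :
    expTotal H s₀ π p₂ m₂ ≤ expTotal H s₀ π p₁ m₁ := by
  rw [← sub_nonneg, expTotal_eq_valueFn H s₀ π p₂, expTotal_sub_expTotal]
  refine Finset.sum_nonneg fun h hh => Finset.sum_nonneg fun s _ => Finset.sum_nonneg fun a _ => ?_
  have hh := Finset.mem_range.mp hh
  exact mul_nonneg (mul_nonneg (stateProb_nonneg hπ hp hh.le s) ((hπ h hh s).1 a)) (hstep h hh s a)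

theorem expTotal_le_expTotal_of_step' {H : ℕ} {s₀ : S} {π : Policy S A} (hπ : IsPolicy H π)
    {p₁ p₂ : S → A → S → ℝ} {m₁ m₂ : S → A → ℝ} (hp : ∀ s a s', 0 ≤ p₁ s a s')
    (hstep : ∀ h < H, ∀ s a,
      m₁ s a - m₂ s a + ∑ s', (p₁ s a s' - p₂ s a s') * valueFn H π p₂ m₂ (h + 1) s' ≤ 0) :
    expTotal H s₀ π p₁ m₁ ≤ expTotal H s₀ π p₂ m₂ := by
  rw [← sub_nonpos, expTotal_eq_valueFn H s₀ π p₂, expTotal_sub_expTotal]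
  refine Finset.sum_nonpos fun h hh => Finset.sum_nonpos fun s _ => Finset.sum_nonpos fun a _ => ?_
  have hh := Finset.mem_range.mp hh
  exact mul_nonpos_of_nonneg_of_nonpos
    (mul_nonneg (stateProb_nonneg hπ hp hh.le s) ((hπ h hh s).1 a)) (hstep h hh s a)

/-- The totals of a policy in two models differ by at most the total of a bound on the one-step
differences of the models. -/
theorem abs_expTotal_sub_le {H : ℕ} {s₀ : S} {π : Policy S A} (hπ : IsPolicy H π)
    {p₁ p₂ : S → A → S → ℝ} {m₁ m₂ g : S → A → ℝ} {b B : ℝ} (hp₁ : ∀ s a s', 0 ≤ p₁ s a s')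
    (hp₂ : ∀ s a s', 0 ≤ p₂ s a s') (hp₂' : ∀ s a, ∑ s', p₂ s a s' ≤ 1) (hb : 0 ≤ b)
    (hm₂ : ∀ s a, |m₂ s a| ≤ b) (hB : (H : ℝ) * b ≤ B)
    (hg : ∀ s a, |m₁ s a - m₂ s a| + B * ∑ s', |p₁ s a s' - p₂ s a s'| ≤ g s a) :
    |expTotal H s₀ π p₁ m₁ - expTotal H s₀ π p₂ m₂| ≤ expTotal H s₀ π p₁ g := by
  rw [expTotal_eq_valueFn H s₀ π p₂, expTotal_sub_expTotal, expTotal]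
  refine (Finset.abs_sum_le_sum_abs _ _).trans (Finset.sum_le_sum fun h hh => ?_)
  refine (Finset.abs_sum_le_sum_abs _ _).trans (Finset.sum_le_sum fun s _ => ?_)
  refine (Finset.abs_sum_le_sum_abs _ _).trans (Finset.sum_le_sum fun a _ => ?_)
  have hh := Finset.mem_range.mp hh
  have hq := mul_nonneg (stateProb_nonneg (s₀ := s₀) hπ hp₁ hh.le s) ((hπ h hh s).1 a)
  rw [abs_mul, abs_of_nonneg hq]
  refine mul_le_mul_of_nonneg_left (le_trans ?_ (hg s a)) hq
  refine (abs_add_le _ _).trans (add_le_add_right ?_ _)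
  rw [Finset.mul_sum]
  refine (Finset.abs_sum_le_sum_abs _ _).trans (Finset.sum_le_sum fun s' _ => ?_)
  rw [abs_mul, mul_comm]
  refine mul_le_mul_of_nonneg_right ?_ (abs_nonneg _)
  refine (abs_valueFn_le hπ hp₂ hp₂' hb hm₂ (Nat.succ_le_of_lt hh) s').trans (le_trans ?_ hB)
  exact mul_le_mul_of_nonneg_right (by exact_mod_cast Nat.sub_le _ _) hb

theorem expTotal_const_mul (H : ℕ) (s₀ : S) (π : Policy S A) (p : S → A → S → ℝ) (x : ℝ)
    (m : S → A → ℝ) :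
    expTotal H s₀ π p (fun s a => x * m s a) = x * expTotal H s₀ π p m := by
  simp only [expTotal, Finset.mul_sum]
  exact Finset.sum_congr rfl fun h _ => Finset.sum_congr rfl fun s _ =>
    Finset.sum_congr rfl fun a _ => by ring

theorem expTotal_mem_Icc {H : ℕ} {s₀ : S} {π : Policy S A} (hπ : IsPolicy H π)
    {p : S → A → S → ℝ} (hp : ∀ s a, p s a ∈ stdSimplex ℝ S) {m : S → A → ℝ}
    (hm : ∀ s a, m s a ∈ Set.Icc (0 : ℝ) 1) :
    expTotal H s₀ π p m ∈ Set.Icc (0 : ℝ) H := by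
  rw [expTotal_eq_valueFn]
  simpa using valueFn_mem_Icc hπ hp hm (Nat.zero_le H) s₀

end Planning

/-! ### Sums of counts over square roots of past counts. -/

section Pigeonhole

/-- The counter is updated only between episodes, so an increment can exceed the past sum `C` while
`C < H`. These early terms are bounded by the increments themselves and add up to at most `2 H`.
Once `C ≥ H`, one increment at most doubles `C`, and `x / √C` is comparable to the increase of the
square root. -/
theorem sum_div_sqrt_cumulative_le {H : ℝ} (hH : 1 ≤ H) (n : ℕ → ℝ) (hn0 : ∀ t, 0 ≤ n t)
    (hn : ∀ t, n t ≤ H) (k : ℕ) :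
    ∑ t ∈ Finset.Ico 1 k, n t / √(max 1 (∑ j ∈ Finset.Ico 1 t, n j)) ≤
      2 * H + 3 * √(∑ j ∈ Finset.Ico 1 k, n j) := by
  -- The minimum makes the early phase self-accounting: while `C < H`, the sum including the next
  -- increment is still below `2 H`, so the minimum is the sum itself.
  suffices h : ∑ t ∈ Finset.Ico 1 k, n t / √(max 1 (∑ j ∈ Finset.Ico 1 t, n j)) ≤
      min (∑ j ∈ Finset.Ico 1 k, n j) (2 * H) + 3 * √(∑ j ∈ Finset.Ico 1 k, n j) from
    h.trans (add_le_add_left (min_le_right _ _) _)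
  induction k with
  | zero => simp; linarith
  | succ k ih =>
    rcases Nat.eq_zero_or_pos k with rfl | hk
    · simp; linarith
    rw [Finset.sum_Ico_succ_top hk, Finset.sum_Ico_succ_top hk]
    have hC0 : 0 ≤ ∑ j ∈ Finset.Ico 1 k, n j := Finset.sum_nonneg fun j _ => hn0 j
    generalize (∑ j ∈ Finset.Ico 1 k, n j) = C at *
    have hx0 := hn0 k
    have hxH := hn k
    generalize n k = x at *
    by_cases hCH : C < H
    · have h1 : x / √(max 1 C) ≤ x := div_le_self hx0 (by
        rw [Real.one_le_sqrt]; exact le_max_left _ _)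
      have h2 : √C ≤ √(C + x) := Real.sqrt_le_sqrt (by linarith)
      rw [min_eq_left (by linarith)] at ih ⊢
      linarith
    · push Not at hCH
      have hC1 : 1 ≤ C := hH.trans hCH
      rw [max_eq_right hC1]
      have hs0 : 0 < √C := Real.sqrt_pos.mpr (by linarith)
      have hsC := Real.sq_sqrt hC0
      have hsx := Real.sq_sqrt (show 0 ≤ C + x by linarith)
      have h1 : √(C + x) ≤ 2 * √C := by
        rw [Real.sqrt_le_left (by positivity)]; nlinarith
      have h2 : √C ≤ √(C + x) := Real.sqrt_le_sqrt (by linarith)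
      have h3 : x / √C ≤ 3 * (√(C + x) - √C) := by
        rw [div_le_iff₀ hs0]
        nlinarith
      have h4 : min C (2 * H) ≤ min (C + x) (2 * H) := min_le_min_right _ (by linarith)
      linarith

end Pigeonhole

/-! ### Scalar exponential inequalities. -/

section ExponentialBounds

/-- Hoeffding's inequality for the moment generating function of a Bernoulli variable. -/
theorem one_sub_add_mul_exp_le {p : ℝ} (hp : p ∈ Set.Icc (0 : ℝ) 1) (u : ℝ) :
    1 - p + p * Real.exp u ≤ Real.exp (p * u + u ^ 2 / 8) := by
  obtain ⟨hp0, hp1⟩ := hp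
  -- The two-point law with mass `p` at `1`, to which Hoeffding's lemma for bounded variables is
  -- applied; an interval of length `1` gives the exponent `u ^ 2 / 8`.
  let ν : Measure ℝ := ENNReal.ofReal (1 - p) • Measure.dirac 0 + ENNReal.ofReal p • Measure.dirac 1
  have hν : IsProbabilityMeasure ν := ⟨by
    simp only [ν, Measure.coe_add, Measure.coe_smul, Pi.add_apply, Pi.smul_apply, measure_univ,
      smul_eq_mul, mul_one]
    rw [← ENNReal.ofReal_add (by linarith) hp0]; simp⟩
  have hint : ∀ f : ℝ → ℝ, ∫ x, f x ∂ν = (1 - p) * f 0 + p * f 1 := by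
    intro f
    rw [integral_add_measure, integral_smul_measure, integral_smul_measure, integral_dirac,
      integral_dirac, ENNReal.toReal_ofReal (by linarith), ENNReal.toReal_ofReal hp0]
    · simp
    · exact (integrable_dirac (by simp)).smul_measure ENNReal.ofReal_ne_top
    · exact (integrable_dirac (by simp)).smul_measure ENNReal.ofReal_ne_top
  have hmem : ∀ᵐ x ∂ν, x ∈ Set.Icc (0 : ℝ) 1 := by
    rw [ae_iff]
    simp only [ν, Measure.coe_add, Measure.coe_smul, Pi.add_apply, Pi.smul_apply]
    have hms : MeasurableSet {x : ℝ | ¬ x ∈ Set.Icc (0 : ℝ) 1} := measurableSet_Icc.compl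
    rw [Measure.dirac_apply' _ hms, Measure.dirac_apply' _ hms]
    simp
  have h := (ProbabilityTheory.hasSubgaussianMGF_of_mem_Icc (μ := ν) (X := id)
    aemeasurable_id hmem).mgf_le u
  simp only [ProbabilityTheory.mgf, hint, id] at h
  have e1 : (1 - p) * (0 : ℝ) + p * 1 = p := by ring
  rw [e1] at h
  have e2 : (((‖(1 : ℝ) - 0‖₊ / 2) ^ 2 : NNReal) : ℝ) * u ^ 2 / 2 = u ^ 2 / 8 := by
    simp; ring
  rw [e2] at h
  have h2 : 1 - p + p * Real.exp u =
      ((1 - p) * Real.exp (u * (0 - p)) + p * Real.exp (u * (1 - p))) * Real.exp (p * u) := by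
    rw [add_mul, mul_assoc, mul_assoc, ← Real.exp_add, ← Real.exp_add]
    have e3 : u * (0 - p) + p * u = 0 := by ring
    have e4 : u * (1 - p) + p * u = u := by ring
    rw [e3, e4, Real.exp_zero, mul_one]
  rw [h2, Real.exp_add, mul_comm (Real.exp (p * u))]
  exact mul_le_mul_of_nonneg_right h (Real.exp_pos _).le

/-- By convexity the exponential lies below its chord between `0` and `u`. -/
theorem exp_mul_le_one_add_mul {w : ℝ} (hw : w ∈ Set.Icc (0 : ℝ) 1) (u : ℝ) :
    Real.exp (u * w) ≤ 1 + w * (Real.exp u - 1) := by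
  have := convexOn_exp.2 (Set.mem_univ 0) (Set.mem_univ u) (sub_nonneg.mpr hw.2) hw.1
    (by ring : 1 - w + w = 1)
  simp only [smul_eq_mul, mul_zero, zero_add, Real.exp_zero, mul_one] at this
  rw [mul_comm u]
  linarith

/-- The chord estimate behind Hoeffding's lemma. -/
theorem exists_exp_sub_le_one_add_mul {lo B mean : ℝ} (hB : 0 < B)
    (hmean : mean ∈ Set.Icc lo (lo + B)) (l : ℝ) :
    ∃ β, ∀ y ∈ Set.Icc lo (lo + B),
      Real.exp (l * (y - mean) - l ^ 2 * B ^ 2 / 8) ≤ 1 + β * (y - mean) := by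
  set u := l * B with hu
  set p := (mean - lo) / B with hp
  have hmem : ∀ y ∈ Set.Icc lo (lo + B), (y - lo) / B ∈ Set.Icc (0 : ℝ) 1 := fun y hy =>
    ⟨div_nonneg (by linarith [hy.1]) hB.le, (div_le_one hB).mpr (by linarith [hy.2])⟩
  have hp01 := hmem mean hmean
  have hpos := Real.exp_pos (-(p * u + u ^ 2 / 8))
  -- `β` is the slope of the chord after normalization. It does not depend on `y`, so the bound is
  -- affine in `y - mean` and integrates to its constant term.
  refine ⟨Real.exp (-(p * u + u ^ 2 / 8)) * (Real.exp u - 1) / B, fun y hy => ?_⟩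
  have h1 := exp_mul_le_one_add_mul (hmem y hy) u
  have h2 := one_sub_add_mul_exp_le hp01 u
  have e1 : l * (y - mean) - l ^ 2 * B ^ 2 / 8 =
      -(p * u + u ^ 2 / 8) + u * ((y - lo) / B) := by
    rw [hp, hu]; field_simp; ring
  have e2 : (y - lo) / B = p + (y - mean) / B := by rw [hp]; ring
  rw [e1, Real.exp_add]
  calc _ ≤ Real.exp (-(p * u + u ^ 2 / 8)) * (1 + (y - lo) / B * (Real.exp u - 1)) :=
        mul_le_mul_of_nonneg_left h1 hpos.le
    _ = Real.exp (-(p * u + u ^ 2 / 8)) * (1 - p + p * Real.exp u) +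
        Real.exp (-(p * u + u ^ 2 / 8)) * (Real.exp u - 1) / B * (y - mean) := by rw [e2]; ring
    _ ≤ Real.exp (-(p * u + u ^ 2 / 8)) * Real.exp (p * u + u ^ 2 / 8) +
        Real.exp (-(p * u + u ^ 2 / 8)) * (Real.exp u - 1) / B * (y - mean) :=
        add_le_add_left (mul_le_mul_of_nonneg_left h2 hpos.le) _
    _ = _ := by rw [← Real.exp_add]; simp

end ExponentialBounds

/-! ### Exponential supermartingales through conditional contractions. -/

section Supermartingale

variable {Ω : Type*}

/-- `exp ξ` has conditional expectation at most `1` given `m`. -/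
def IsExpContraction {mΩ : MeasurableSpace Ω} (μ : Measure Ω) (m : MeasurableSpace Ω)
    (ξ : Ω → ℝ) : Prop :=
  ∀ A, MeasurableSet[m] A → ∫⁻ ω in A, ENNReal.ofReal (Real.exp (ξ ω)) ∂μ ≤ μ A

variable {m m' : MeasurableSpace Ω} [mΩ : MeasurableSpace Ω] {μ : Measure Ω}

/-- The set-wise condition says that on `m` the measure with density `exp ξ` is dominated by `μ`;
integrating an `m`-measurable weight preserves this. -/
theorem IsExpContraction.lintegral_mul_le (hm : m ≤ mΩ) {ξ : Ω → ℝ}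
    (hξ : Measurable ξ) (h : IsExpContraction μ m ξ) {W : Ω → ENNReal} (hW : Measurable[m] W) :
    ∫⁻ ω, W ω * ENNReal.ofReal (Real.exp (ξ ω)) ∂μ ≤ ∫⁻ ω, W ω ∂μ := by
  have hmeas : Measurable fun ω => ENNReal.ofReal (Real.exp (ξ ω)) :=
    (Real.measurable_exp.comp hξ).ennreal_ofReal
  have hle : (μ.withDensity fun ω => ENNReal.ofReal (Real.exp (ξ ω))).trim hm ≤ μ.trim hm := by
    refine @Measure.le_intro _ m _ _ fun A hA _ => ?_
    rw [trim_measurableSet_eq hm hA, trim_measurableSet_eq hm hA, withDensity_apply _ (hm A hA)]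
    exact h A hA
  calc ∫⁻ ω, W ω * ENNReal.ofReal (Real.exp (ξ ω)) ∂μ
      = ∫⁻ ω, W ω ∂(μ.withDensity fun ω => ENNReal.ofReal (Real.exp (ξ ω))) := by
        rw [lintegral_withDensity_eq_lintegral_mul _ hmeas (hW.mono hm le_rfl)]
        simp [mul_comm]
    _ = ∫⁻ ω, W ω ∂((μ.withDensity fun ω => ENNReal.ofReal (Real.exp (ξ ω))).trim hm) :=
        (lintegral_trim hm hW).symm
    _ ≤ ∫⁻ ω, W ω ∂(μ.trim hm) := lintegral_mono' hle le_rfl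
    _ = ∫⁻ ω, W ω ∂μ := lintegral_trim hm hW

/-- The supermartingale property: the last factor is integrated out first, with the indicator of `A`
times the exponential of the earlier sum as a weight known at time `n`. -/
theorem IsExpContraction.sum {𝒢 : ℕ → MeasurableSpace Ω} {n : ℕ} {ξ : ℕ → Ω → ℝ}
    (hmono : Monotone 𝒢) (hle : ∀ j, 𝒢 j ≤ mΩ)
    (hξ : ∀ j < n, Measurable[𝒢 (j + 1)] (ξ j)) (h : ∀ j < n, IsExpContraction μ (𝒢 j) (ξ j)) :
    IsExpContraction μ (𝒢 0) (fun ω => ∑ j ∈ Finset.range n, ξ j ω) := by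
  induction n with
  | zero => intro A _; simp
  | succ n ih =>
    intro A hA
    refine le_trans ?_ (ih (fun j hj => hξ j (by omega)) (fun j hj => h j (by omega)) A hA)
    have hA' := hmono (Nat.zero_le n) A hA
    have hAm := hle 0 A hA
    have hS : Measurable[𝒢 n] fun ω => ∑ j ∈ Finset.range n, ξ j ω :=
      Finset.measurable_sum _ fun j hj =>
        (hξ j (by have := Finset.mem_range.mp hj; omega)).mono
          (hmono (by have := Finset.mem_range.mp hj; omega)) le_rfl
    have hW : Measurable[𝒢 n] (A.indicator fun ω =>
        ENNReal.ofReal (Real.exp (∑ j ∈ Finset.range n, ξ j ω))) :=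
      ((Real.measurable_exp.comp hS).ennreal_ofReal).indicator hA'
    have := (h n (by omega)).lintegral_mul_le (hle n) ((hξ n (by omega)).mono (hle _) le_rfl) hW
    rw [lintegral_indicator hAm] at this
    refine le_trans (le_of_eq ?_) this
    rw [← lintegral_indicator hAm]
    refine lintegral_congr fun ω => ?_
    by_cases hω : ω ∈ A
    · simp only [Set.indicator_of_mem hω, Finset.sum_range_succ, Real.exp_add]
      rw [ENNReal.ofReal_mul (Real.exp_pos _).le]
    · simp [hω]

theorem IsExpContraction.measure_ge_le [IsProbabilityMeasure μ]
    {ξ : Ω → ℝ} (hξ : Measurable ξ) (h : IsExpContraction μ m ξ) (x : ℝ) :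
    μ {ω | x ≤ ξ ω} ≤ ENNReal.ofReal (Real.exp (-x)) := by
  have h1 : ∫⁻ ω, ENNReal.ofReal (Real.exp (ξ ω)) ∂μ ≤ 1 := by
    simpa using h Set.univ (@MeasurableSet.univ _ m)
  have h2 := mul_meas_ge_le_lintegral (μ := μ)
    (f := fun ω => ENNReal.ofReal (Real.exp (ξ ω)))
    (Real.measurable_exp.comp hξ).ennreal_ofReal (ENNReal.ofReal (Real.exp x))
  have h3 : {ω | x ≤ ξ ω} ⊆
      {ω | ENNReal.ofReal (Real.exp x) ≤ ENNReal.ofReal (Real.exp (ξ ω))} := fun ω hω =>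
    ENNReal.ofReal_le_ofReal (Real.exp_le_exp.mpr hω)
  have h4 : ENNReal.ofReal (Real.exp x) * μ {ω | x ≤ ξ ω} ≤ 1 :=
    (mul_le_mul_right (measure_mono h3) _).trans (h2.trans h1)
  rw [Real.exp_neg, ENNReal.ofReal_inv_of_pos (Real.exp_pos x)]
  rwa [ENNReal.le_inv_iff_mul_le, mul_comm]

/-- Centered bounded outcomes, observed on an event `Z` on which their conditional mean is
constant. -/
theorem isExpContraction_indicator [IsProbabilityMeasure μ]
    (hmm : m ≤ m') (hm' : m' ≤ mΩ) {Z : Set Ω} (hZ : MeasurableSet[m'] Z) {Y : Ω → ℝ}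
    (hY : Measurable Y) {lo B mean : ℝ} (hB : 0 < B) (hmean : mean ∈ Set.Icc lo (lo + B))
    (hYmem : ∀ᵐ ω ∂μ, Y ω ∈ Set.Icc lo (lo + B))
    (hcond : ∀ A, MeasurableSet[m'] A → A ⊆ Z → ∫ ω in A, Y ω ∂μ = mean * μ.real A) (l : ℝ) :
    IsExpContraction μ m (Z.indicator fun ω => l * (Y ω - mean) - l ^ 2 * B ^ 2 / 8) := by
  intro A hA
  obtain ⟨β, hβ⟩ := exists_exp_sub_le_one_add_mul hB hmean l
  have hAm := hm' _ (hmm A hA)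
  have hZm := hm' _ hZ
  have hYint : Integrable Y μ := Integrable.of_mem_Icc _ _ hY.aemeasurable hYmem
  -- This affine majorant exceeds `1` by a multiple of `Y - mean` on `Z`, whose integral over `A ∩
  -- Z`, an event of `m'`, is zero.
  set f : Ω → ℝ := fun ω => 1 + Z.indicator (fun ω => β * (Y ω - mean)) ω with hf
  have hfint : Integrable f μ := (integrable_const _).add
    (((hYint.sub (integrable_const _)).const_mul β).indicator hZm)
  have hbound : ∀ᵐ ω ∂μ, Real.exp (Z.indicator
      (fun ω => l * (Y ω - mean) - l ^ 2 * B ^ 2 / 8) ω) ≤ f ω := by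
    filter_upwards [hYmem] with ω hω
    by_cases hωZ : ω ∈ Z
    · simpa [hf, hωZ] using hβ _ hω
    · simp [hf, hωZ]
  calc _ ≤ ∫⁻ ω in A, ENNReal.ofReal (f ω) ∂μ :=
        lintegral_mono_ae ((ae_restrict_of_ae hbound).mono fun ω hω =>
          ENNReal.ofReal_le_ofReal hω)
    _ = ENNReal.ofReal (∫ ω in A, f ω ∂μ) := by
        rw [ofReal_integral_eq_lintegral_ofReal hfint.integrableOn]
        exact (ae_restrict_of_ae hbound).mono fun ω hω => (Real.exp_pos _).le.trans hω
    _ = ENNReal.ofReal (μ.real A) := by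
        have h1 : ∫ ω in A, Z.indicator (fun ω => β * (Y ω - mean)) ω ∂μ = 0 := by
          rw [setIntegral_indicator hZm, integral_const_mul, integral_sub hYint.integrableOn
            (integrable_const _), hcond (A ∩ Z) (@MeasurableSet.inter _ m' _ _ (hmm A hA) hZ)
            Set.inter_subset_right]
          simp [mul_comm]
        have h2 : Integrable (Z.indicator fun ω => β * (Y ω - mean)) μ :=
          ((hYint.sub (integrable_const _)).const_mul β).indicator hZm
        rw [hf, integral_add (integrable_const _) h2.integrableOn, h1]
        simp
    _ = μ A := by simp

/-- The chord of `exp (-x)` on `[0, 1]` has slope `exp (-1) - 1 ≤ -1/2`. Paired with `1 - E / 2 ≤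
exp (-(E / 2))`, it lets half of a conditional mean be compensated by the variable, with no variance
term. -/
theorem exp_neg_le_one_sub_half {x : ℝ} (hx : x ∈ Set.Icc (0 : ℝ) 1) :
    Real.exp (-x) ≤ 1 - x / 2 := by
  have h := exp_mul_le_one_add_mul hx (-1)
  have h2 : Real.exp (-1) ≤ 1 / 2 := by
    rw [Real.exp_neg, inv_le_comm₀ (Real.exp_pos 1) (by norm_num)]
    linarith [Real.add_one_le_exp (1 : ℝ)]
  rw [neg_one_mul] at h
  nlinarith [hx.1]

/-- The multiplicative comparison of a variable in `[0, 1]` with its conditional mean. -/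
theorem isExpContraction_half_sub [IsProbabilityMeasure μ]
    (hm : m ≤ mΩ) {X E : Ω → ℝ} (hX : Measurable X) (hE : Measurable[m] E)
    (hXmem : ∀ ω, X ω ∈ Set.Icc (0 : ℝ) 1) (hEmem : ∀ ω, E ω ∈ Set.Icc (0 : ℝ) 1)
    (hcond : ∀ W : Ω → ℝ, Measurable[m] W → (∃ C, ∀ ω, |W ω| ≤ C) →
      ∫ ω, W ω * X ω ∂μ = ∫ ω, W ω * E ω ∂μ) :
    IsExpContraction μ m (fun ω => E ω / 2 - X ω) := by
  intro A hA
  have hAm := hm A hA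
  -- This weight is known at `m`, so `hcond` may replace `X` by `E` after `exp (-X)` has been
  -- bounded by an affine function of `X`.
  set W : Ω → ℝ := A.indicator fun ω => Real.exp (E ω / 2) with hW
  have hWm : Measurable[m] W := (Real.measurable_exp.comp (hE.div_const 2)).indicator hA
  have hWb : ∀ ω, |W ω| ≤ Real.exp 1 := fun ω => by
    by_cases hω : ω ∈ A
    · simp only [hW, Set.indicator_of_mem hω, abs_of_pos (Real.exp_pos _)]
      exact Real.exp_le_exp.mpr (by linarith [(hEmem ω).2])
    · simp [hW, hω, (Real.exp_pos 1).le]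
  have hWint : Integrable W μ := Integrable.of_bound (hWm.mono hm le_rfl).aestronglyMeasurable
    (Real.exp 1) (Filter.Eventually.of_forall hWb)
  have hmul : ∀ V : Ω → ℝ, Measurable V → (∀ ω, V ω ∈ Set.Icc (0 : ℝ) 1) →
      Integrable (fun ω => W ω * V ω) μ := fun V hV hV1 =>
    Integrable.of_bound ((hWm.mono hm le_rfl).mul hV).aestronglyMeasurable (Real.exp 1)
      (Filter.Eventually.of_forall fun ω => by
        rw [Real.norm_eq_abs, abs_mul, abs_of_nonneg (hV1 ω).1]
        exact (mul_le_of_le_one_right (abs_nonneg _) (hV1 ω).2).trans (hWb ω))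
  have hWX := hmul X hX hXmem
  have hWE := hmul E (hE.mono hm le_rfl) hEmem
  have hW0 : ∀ ω, 0 ≤ W ω := fun ω => Set.indicator_nonneg (fun _ _ => (Real.exp_pos _).le) ω
  calc _ = ∫⁻ ω, A.indicator (fun ω => ENNReal.ofReal (Real.exp (E ω / 2 - X ω))) ω ∂μ :=
        (lintegral_indicator hAm _).symm
    _ ≤ ∫⁻ ω, ENNReal.ofReal (W ω - W ω * X ω / 2) ∂μ := by
        refine lintegral_mono fun ω => ?_
        by_cases hω : ω ∈ A
        · simp only [Set.indicator_of_mem hω, hW]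
          refine ENNReal.ofReal_le_ofReal ?_
          rw [sub_eq_add_neg, Real.exp_add]
          calc _ ≤ Real.exp (E ω / 2) * (1 - X ω / 2) :=
                mul_le_mul_of_nonneg_left (exp_neg_le_one_sub_half (hXmem ω)) (Real.exp_pos _).le
            _ = _ := by ring
        · simp [hω]
    _ = ENNReal.ofReal (∫ ω, (W ω - W ω * X ω / 2) ∂μ) := by
        have hint : Integrable (fun ω => W ω - W ω * X ω / 2) μ := hWint.sub (hWX.div_const 2)
        rw [ofReal_integral_eq_lintegral_ofReal hint]
        refine Filter.Eventually.of_forall fun ω => ?_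
        have := hW0 ω
        have := (hXmem ω).2
        simp only [Pi.zero_apply]
        nlinarith
    _ = ENNReal.ofReal (∫ ω, (W ω - W ω * E ω / 2) ∂μ) := by
        rw [integral_sub hWint (hWX.div_const 2), integral_sub hWint (hWE.div_const 2),
          integral_div, integral_div, hcond W hWm ⟨_, hWb⟩]
    _ ≤ ENNReal.ofReal (∫ ω, A.indicator 1 ω ∂μ) := by
        refine ENNReal.ofReal_le_ofReal (integral_mono (hWint.sub (hWE.div_const 2))
          ((integrable_const 1).indicator hAm) fun ω => ?_)
        by_cases hω : ω ∈ A
        · simp only [hW, Set.indicator_of_mem hω, Pi.one_apply]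
          have h1 := Real.add_one_le_exp (-(E ω / 2))
          have h2 := mul_le_mul_of_nonneg_left h1 (Real.exp_pos (E ω / 2)).le
          rw [← Real.exp_add, add_neg_cancel, Real.exp_zero] at h2
          linarith
        · simp [hW, hω]
    _ = μ A := by rw [integral_indicator_one hAm]; simp

end Supermartingale

/-! ### Measurability of functions of finitely valued variables. -/

section Measurability

variable {Ω X : Type*} {mΩ : MeasurableSpace Ω}

/-- The sets of states and actions carry no σ-algebra; measurability of a state is expressed by its
level sets. -/
theorem measurable_comp_of_finite [Finite X] {x : Ω → X}
    (hx : ∀ i, MeasurableSet {ω | x ω = i}) (f : X → ℝ) : Measurable fun ω => f (x ω) := by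
  intro B _
  have : (fun ω => f (x ω)) ⁻¹' B = ⋃ i ∈ {i | f i ∈ B}, {ω | x ω = i} := by
    ext ω; simp
  rw [this]
  exact MeasurableSet.biUnion (Set.to_countable _) fun i _ => hx i

theorem measurable_one_ite {p : Ω → Prop} [DecidablePred p] (hp : MeasurableSet {ω | p ω}) :
    Measurable fun ω => if p ω then (1 : ℝ) else 0 :=
  Measurable.ite hp measurable_const measurable_const

end Measurability

/-! ### Conditional expectations in tested form. -/

section Conditioning

variable {Ω : Type*} {m : MeasurableSpace Ω} [mΩ : MeasurableSpace Ω] {μ : Measure Ω}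

theorem setIntegral_eq_const_mul_of_condExp [IsProbabilityMeasure μ] (hm : m ≤ mΩ) {f g : Ω → ℝ}
    (hf : Integrable f μ) (hfg : μ[f | m] =ᵐ[μ] g) {A : Set Ω} (hA : MeasurableSet[m] A) {c : ℝ}
    (hc : ∀ ω ∈ A, g ω = c) : ∫ ω in A, f ω ∂μ = c * μ.real A := by
  rw [← setIntegral_condExp hm hf hA, setIntegral_congr_ae (g := fun _ => c) (hm A hA)
    (hfg.mono fun ω h hω => h.trans (hc ω hω))]
  simp [mul_comm]

theorem integral_mul_eq_of_condExp [IsProbabilityMeasure μ] (hm : m ≤ mΩ) {f g W : Ω → ℝ}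
    (hf : Integrable f μ) (hfg : μ[f | m] =ᵐ[μ] g) (hW : Measurable[m] W)
    (hWb : ∃ C, ∀ ω, |W ω| ≤ C) : ∫ ω, W ω * f ω ∂μ = ∫ ω, W ω * g ω ∂μ := by
  obtain ⟨C, hC⟩ := hWb
  have hWf : Integrable (W * f) μ := hf.bdd_mul (c := C) (hW.mono hm le_rfl).aestronglyMeasurable
    (Filter.Eventually.of_forall hC)
  have h1 := condExp_mul_of_stronglyMeasurable_left hW.stronglyMeasurable hWf hf
  calc ∫ ω, W ω * f ω ∂μ = ∫ ω, (μ[W * f | m]) ω ∂μ := (integral_condExp hm).symm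
    _ = _ := integral_congr_ae (h1.trans (hfg.mono fun ω h => by simp [h]))

theorem integrable_one_ite [IsProbabilityMeasure μ] {p : Ω → Prop} [DecidablePred p]
    (hp : MeasurableSet {ω | p ω}) : Integrable (fun ω => if p ω then (1 : ℝ) else 0) μ :=
  Integrable.of_bound (measurable_one_ite hp).aestronglyMeasurable 1
    (Filter.Eventually.of_forall fun ω => by split_ifs <;> simp)

end Conditioning

/-! ### The clock of half-steps. -/

section Times

theorem preTime_le_postTime (H k h : ℕ) : preTime H k h ≤ postTime H k h := by
  simp [preTime, postTime]

theorem postTime_le_preTime_succ (H k h : ℕ) : postTime H k h ≤ preTime H k (h + 1) := by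
  simp only [preTime, postTime]; omega

theorem preTime_mono (H k : ℕ) : Monotone (preTime H k) := fun a b h => by
  simp only [preTime]; omega

theorem preTime_horizon (H k : ℕ) : preTime H k H = preTime H (k + 1) 0 := by
  simp only [preTime]; ring

theorem preTime_zero_mono (H : ℕ) : Monotone fun k => preTime H k 0 := fun a b h => by
  have := Nat.mul_le_mul_right H h
  simp only [preTime]; omega

theorem preTime_le_preTime_of_lt {H t k h : ℕ} (ht : t < k) (hh : h ≤ H) :
    preTime H t h ≤ preTime H k 0 :=
  (preTime_mono H t hh).trans ((preTime_horizon H t).le.trans (preTime_zero_mono H ht))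

end Times

/-! ### Hoeffding's inequality along the visits of a pair. -/

section Protocol

set_option linter.unusedSectionVars false

variable {S A ι Ω : Type*} [Fintype S] [DecidableEq S] [Fintype A] [DecidableEq A]
  {m : MeasurableSpace Ω} [mΩ : MeasurableSpace Ω] {μ : Measure Ω} {ℱ : Filtration ℕ mΩ}
  {H : ℕ} {s₀ : S} {M : CMDP S A ι} {π : ℕ → Ω → Policy S A} {O : Observations S A ι Ω}

/-- The event that `(s, a)` is visited at step `h` of episode `t`. -/
def visitEvent (O : Observations S A ι Ω) (t h : ℕ) (s : S) (a : A) : Set Ω :=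
  {ω | O.state t h ω = s ∧ O.action t h ω = a}

theorem mem_visitEvent {t h : ℕ} {s : S} {a : A} {ω : Ω} :
    ω ∈ visitEvent O t h s a ↔ O.state t h ω = s ∧ O.action t h ω = a := Iff.rfl

/-- The number of visits of `(s, a)` before episode `k`. -/
def rawCount (H : ℕ) (O : Observations S A ι Ω) (k : ℕ) (ω : Ω) (s : S) (a : A) : ℝ :=
  ∑ t ∈ Finset.Ico 1 k, ∑ h ∈ Finset.range H,
    if O.state t h ω = s ∧ O.action t h ω = a then 1 else 0

theorem measurableSet_visitEvent (hFP : FollowsProtocol μ ℱ H s₀ M π O) {t h : ℕ} (ht : 1 ≤ t)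
    (hh : h < H) (s : S) (a : A) : MeasurableSet[ℱ (postTime H t h)] (visitEvent O t h s a) :=
  @MeasurableSet.inter _ (ℱ (postTime H t h)) _ _
    (ℱ.mono (preTime_le_postTime H t h) _ (hFP.measurable_state t ht h hh.le s))
    (hFP.measurable_action t ht h hh a)

theorem measurable_rawCount (hFP : FollowsProtocol μ ℱ H s₀ M π O) (k : ℕ) (s : S) (a : A) :
    Measurable[ℱ (preTime H k 0)] fun ω => rawCount H O k ω s a := by
  refine Finset.measurable_sum _ fun t ht => Finset.measurable_sum _ fun h hh => ?_
  have ht := Finset.mem_Ico.mp ht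
  have hh := Finset.mem_range.mp hh
  exact measurable_one_ite (ℱ.mono ((postTime_le_preTime_succ H t h).trans
    (preTime_le_preTime_of_lt ht.2 hh)) _ (measurableSet_visitEvent hFP ht.1 hh s a))

theorem isExpContraction_sum_episodes (ξ : ℕ → Ω → ℝ) (k : ℕ)
    (hξ : ∀ t, 1 ≤ t → Measurable[ℱ (preTime H (t + 1) 0)] (ξ t))
    (h : ∀ t, 1 ≤ t → IsExpContraction μ (ℱ (preTime H t 0)) (ξ t)) :
    IsExpContraction μ (ℱ (preTime H 1 0)) (fun ω => ∑ t ∈ Finset.Ico 1 k, ξ t ω) := by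
  simp only [Finset.sum_Ico_eq_sum_range, Nat.add_comm 1]
  exact IsExpContraction.sum (𝒢 := fun j => ℱ (preTime H (j + 1) 0))
    (ξ := fun j => ξ (j + 1)) (fun i j hij => ℱ.mono (preTime_zero_mono H (by omega)))
    (fun j => ℱ.le _) (fun j _ => hξ _ (by omega)) (fun j _ => h _ (by omega))

/-- Contractions are chained within each episode and then across episodes; the two fit together
because an episode ends at the time at which the next one begins. -/
theorem isExpContraction_sum_steps (ξ : ℕ → ℕ → Ω → ℝ) (k : ℕ)
    (hξ : ∀ t, 1 ≤ t → ∀ h < H, Measurable[ℱ (preTime H t (h + 1))] (ξ t h))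
    (h : ∀ t, 1 ≤ t → ∀ h < H, IsExpContraction μ (ℱ (preTime H t h)) (ξ t h)) :
    IsExpContraction μ (ℱ (preTime H 1 0))
      (fun ω => ∑ t ∈ Finset.Ico 1 k, ∑ h ∈ Finset.range H, ξ t h ω) := by
  refine isExpContraction_sum_episodes (fun t ω => ∑ h ∈ Finset.range H, ξ t h ω) k
    (fun t ht => Finset.measurable_sum _ fun j hj => ?_) fun t ht => ?_
  · exact (hξ t ht j (Finset.mem_range.mp hj)).mono
      (ℱ.mono (preTime_le_preTime_of_lt (Nat.lt_succ_self t) (Finset.mem_range.mp hj))) le_rfl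
  · exact IsExpContraction.sum (𝒢 := fun j => ℱ (preTime H t j))
      (fun i j hij => ℱ.mono (preTime_mono H t hij)) (fun j => ℱ.le _) (hξ t ht) (h t ht)

/-- Integrality leaves few possible values of the count, over which a union bound is affordable; it
also makes the truncation at `1` matter only for unvisited pairs. -/
theorem exists_nat_rawCount_eq (H : ℕ) (O : Observations S A ι Ω) (k : ℕ) (ω : Ω) (s : S)
    (a : A) : ∃ n : ℕ, n ≤ k * H ∧ rawCount H O k ω s a = n := by
  refine ⟨∑ t ∈ Finset.Ico 1 k, ∑ h ∈ Finset.range H,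
    if O.state t h ω = s ∧ O.action t h ω = a then 1 else 0, ?_, by simp [rawCount]⟩
  calc _ ≤ ∑ t ∈ Finset.Ico 1 k, ∑ h ∈ Finset.range H, 1 :=
        Finset.sum_le_sum fun t _ => Finset.sum_le_sum fun h _ => by split_ifs <;> simp
    _ ≤ k * H := by simp; exact Nat.mul_le_mul_right _ (Nat.sub_le _ _)

/-- Hoeffding's inequality for the outcomes observed on the visits of `(s, a)` before episode `k`,
uniformly over the (random) number of visits. -/
theorem measure_abs_sum_visits_ge_le [IsProbabilityMeasure μ]
    (hFP : FollowsProtocol μ ℱ H s₀ M π O) (s : S) (a : A) (Y : ℕ → ℕ → Ω → ℝ) {lo B mean : ℝ}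
    (hB : 0 < B) (hmean : mean ∈ Set.Icc lo (lo + B))
    (hY : ∀ t, 1 ≤ t → ∀ h < H, Measurable[ℱ (preTime H t (h + 1))] (Y t h))
    (hYmem : ∀ t, 1 ≤ t → ∀ h < H, ∀ᵐ ω ∂μ, Y t h ω ∈ Set.Icc lo (lo + B))
    (hcond : ∀ t, 1 ≤ t → ∀ h < H, ∀ E, MeasurableSet[ℱ (postTime H t h)] E →
      E ⊆ visitEvent O t h s a → ∫ ω in E, Y t h ω ∂μ = mean * μ.real E)
    (k : ℕ) {x : ℝ} (hx : 0 ≤ x) :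
    μ {ω | 1 ≤ rawCount H O k ω s a ∧ B * √(rawCount H O k ω s a * x / 2) ≤
      |∑ t ∈ Finset.Ico 1 k, ∑ h ∈ Finset.range H,
        (visitEvent O t h s a).indicator (fun ω => Y t h ω - mean) ω|} ≤
      ENNReal.ofReal (2 * (k * H) * Real.exp (-x)) := by
  set T : Ω → ℝ := fun ω => ∑ t ∈ Finset.Ico 1 k, ∑ h ∈ Finset.range H,
        (visitEvent O t h s a).indicator (fun ω => Y t h ω - mean) ω with hT
  set C : Ω → ℝ := fun ω => rawCount H O k ω s a with hC
  have hTm : Measurable T := Finset.measurable_sum _ fun t ht => Finset.measurable_sum _ fun h hh =>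
    (((hY t (Finset.mem_Ico.mp ht).1 h (Finset.mem_range.mp hh)).mono (ℱ.le _) le_rfl).sub_const
      _).indicator (ℱ.le _ _ (measurableSet_visitEvent hFP (Finset.mem_Ico.mp ht).1
        (Finset.mem_range.mp hh) s a))
  have hCm : Measurable C := (measurable_rawCount hFP k s a).mono (ℱ.le _) le_rfl
  -- The compensator is proportional to the random count `C`, since steps without a visit contribute
  -- nothing.
  have hcontr : ∀ l : ℝ, IsExpContraction μ (ℱ (preTime H 1 0))
      fun ω => l * T ω - l ^ 2 * B ^ 2 / 8 * C ω := by
    intro l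
    have h := isExpContraction_sum_steps (μ := μ) (ℱ := ℱ) (H := H)
      (fun t h => (visitEvent O t h s a).indicator
        fun ω => l * (Y t h ω - mean) - l ^ 2 * B ^ 2 / 8) k
      (fun t ht h hh => (((hY t ht h hh).sub_const _).const_mul l |>.sub_const _).indicator
        (ℱ.mono (postTime_le_preTime_succ H t h) _ (measurableSet_visitEvent hFP ht hh s a)))
      (fun t ht h hh => isExpContraction_indicator (ℱ.mono (preTime_le_postTime H t h)) (ℱ.le _)
        (measurableSet_visitEvent hFP ht hh s a) ((hY t ht h hh).mono (ℱ.le _) le_rfl) hB hmean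
        (hYmem t ht h hh) (hcond t ht h hh) l)
    convert h using 2 with ω
    simp only [hT, hC, rawCount, Finset.mul_sum, ← Finset.sum_sub_distrib]
    refine Finset.sum_congr rfl fun t _ => Finset.sum_congr rfl fun h _ => ?_
    by_cases hω : ω ∈ visitEvent O t h s a
    · rw [Set.indicator_of_mem hω, Set.indicator_of_mem hω, if_pos (mem_visitEvent.mp hω)]; ring
    · rw [Set.indicator_of_notMem hω, Set.indicator_of_notMem hω,
        if_neg (mt mem_visitEvent.mpr hω)]
      ring
  have htail : ∀ l : ℝ, μ {ω | x ≤ l * T ω - l ^ 2 * B ^ 2 / 8 * C ω} ≤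
      ENNReal.ofReal (Real.exp (-x)) := fun l =>
    (hcontr l).measure_ge_le ((hTm.const_mul l).sub (hCm.const_mul _)) x
  -- The maximizer of `l * (B * √(n * x / 2)) - l ^ 2 * B ^ 2 / 8 * n`, with maximal value `x`. As
  -- it depends on the count, the union runs over all `n ≤ k * H` and both signs, whence the factor
  -- `2 * (k * H)`.
  set l : ℕ → ℝ := fun n => 4 * √(n * x / 2) / (n * B) with hl
  have hsub : {ω | 1 ≤ C ω ∧ B * √(C ω * x / 2) ≤ |T ω|} ⊆
      ⋃ n ∈ Finset.Icc 1 (k * H), ({ω | x ≤ l n * T ω - l n ^ 2 * B ^ 2 / 8 * C ω} ∪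
        {ω | x ≤ (-l n) * T ω - (-l n) ^ 2 * B ^ 2 / 8 * C ω}) := by
    rintro ω ⟨h1, h2⟩
    obtain ⟨n, hn, hCn⟩ := exists_nat_rawCount_eq H O k ω s a
    change C ω = n at hCn
    rw [hCn] at h1 h2
    have hn1 : 1 ≤ n := by exact_mod_cast h1
    have hn0 : (0 : ℝ) < n := by linarith
    have hl0 : 0 ≤ l n := by positivity
    have key : l n * (B * √(n * x / 2)) - l n ^ 2 * B ^ 2 / 8 * n = x := by
      have hs := Real.sq_sqrt (show 0 ≤ (n : ℝ) * x / 2 by positivity)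
      simp only [hl]
      field_simp
      rw [hs]
      ring
    simp only [Set.mem_iUnion, Finset.mem_Icc, Set.mem_union, Set.mem_ofPred_eq, exists_prop]
    refine ⟨n, ⟨hn1, hn⟩, ?_⟩
    rw [hCn]
    rcases le_abs.mp h2 with h | h
    · left
      linarith [mul_le_mul_of_nonneg_left h hl0]
    · right
      have := mul_le_mul_of_nonneg_left h hl0
      rw [neg_sq]
      linarith
  calc _ ≤ _ := measure_mono hsub
    _ ≤ ∑ n ∈ Finset.Icc 1 (k * H), (ENNReal.ofReal (Real.exp (-x)) +
        ENNReal.ofReal (Real.exp (-x))) :=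
        (measure_biUnion_finset_le _ _).trans (Finset.sum_le_sum fun n _ =>
          (measure_union_le _ _).trans (add_le_add (htail _) (htail _)))
    _ = _ := by
        rw [Finset.sum_const, Nat.card_Icc, ← ENNReal.ofReal_add (Real.exp_pos _).le
          (Real.exp_pos _).le, nsmul_eq_mul, ← ENNReal.ofReal_natCast,
          ← ENNReal.ofReal_mul (by positivity)]
        congr 1
        push_cast [Nat.add_sub_cancel]
        ring

end Protocol

/-! ### Accuracy of empirical means and transitions. -/

section Estimation

set_option linter.unusedSectionVars false

variable {S A ι Ω : Type*} [Fintype S] [DecidableEq S] [Fintype A] [DecidableEq A]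
  [mΩ : MeasurableSpace Ω] {μ : Measure Ω} {ℱ : Filtration ℕ mΩ}
  {H : ℕ} {s₀ : S} {M : CMDP S A ι} {π : ℕ → Ω → Policy S A} {O : Observations S A ι Ω}

theorem visitCount_eq_max (H : ℕ) (O : Observations S A ι Ω) (k : ℕ) (ω : Ω) (s : S) (a : A) :
    visitCount H O k ω s a = max 1 (rawCount H O k ω s a) := rfl

theorem one_le_visitCount (H : ℕ) (O : Observations S A ι Ω) (k : ℕ) (ω : Ω) (s : S) (a : A) :
    1 ≤ visitCount H O k ω s a := le_max_left _ _

theorem rawCount_eq_zero_or_visitCount_eq (H : ℕ) (O : Observations S A ι Ω) (k : ℕ) (ω : Ω)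
    (s : S) (a : A) : rawCount H O k ω s a = 0 ∨
      (1 ≤ rawCount H O k ω s a ∧ visitCount H O k ω s a = rawCount H O k ω s a) := by
  obtain ⟨n, -, h⟩ := exists_nat_rawCount_eq H O k ω s a
  rw [visitCount_eq_max, h]
  rcases Nat.eq_zero_or_pos n with rfl | hn
  · left; simp
  · have : (1 : ℝ) ≤ n := by exact_mod_cast hn
    exact Or.inr ⟨this, max_eq_right this⟩

theorem empTransition_nonneg (H : ℕ) (O : Observations S A ι Ω) (k : ℕ) (ω : Ω) (s : S) (a : A)
    (s' : S) : 0 ≤ empTransition H O k ω s a s' :=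
  div_nonneg (Finset.sum_nonneg fun _ _ => Finset.sum_nonneg fun _ _ => by split_ifs <;> norm_num)
    (zero_le_one.trans (one_le_visitCount H O k ω s a))

/-- An integral against the empirical row is the empirical mean of `V` at the next state, so
transition errors become deviations of sums over visits. -/
theorem sum_empTransition_mul (H : ℕ) (O : Observations S A ι Ω) (k : ℕ) (ω : Ω) (s : S) (a : A)
    (V : S → ℝ) : ∑ s', empTransition H O k ω s a s' * V s' =
      (∑ t ∈ Finset.Ico 1 k, ∑ h ∈ Finset.range H,
        if O.state t h ω = s ∧ O.action t h ω = a then V (O.state t (h + 1) ω) else 0) /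
        visitCount H O k ω s a := by
  simp only [empTransition, div_mul_eq_mul_div]
  rw [← Finset.sum_div]
  congr 1
  simp only [Finset.sum_mul]
  rw [Finset.sum_comm]
  refine Finset.sum_congr rfl fun t _ => ?_
  rw [Finset.sum_comm]
  refine Finset.sum_congr rfl fun h _ => ?_
  by_cases hv : O.state t h ω = s ∧ O.action t h ω = a
  · simp [hv]
  · rw [if_neg hv]
    refine Finset.sum_eq_zero fun s' _ => ?_
    rw [if_neg (fun h => hv ⟨h.1, h.2.1⟩), zero_mul]

/-- The mass is the raw count over the truncated count: `1` for visited pairs, `0` for the others.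
-/
theorem sum_empTransition_le_one (H : ℕ) (O : Observations S A ι Ω) (k : ℕ) (ω : Ω) (s : S)
    (a : A) : ∑ s', empTransition H O k ω s a s' ≤ 1 := by
  have h := sum_empTransition_mul H O k ω s a (fun _ => 1)
  simp only [mul_one] at h
  rw [h]
  exact (div_le_one (zero_lt_one.trans_le (one_le_visitCount H O k ω s a))).mpr (le_max_right _ _)

/-- The empirical mean of the outcomes `Y` on the visits of `(s, a)` before episode `k`. -/
noncomputable def empMean (H : ℕ) (O : Observations S A ι Ω) (Y : ℕ → ℕ → Ω → ℝ) (k : ℕ) (ω : Ω)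
    (s : S) (a : A) : ℝ :=
  (∑ t ∈ Finset.Ico 1 k, ∑ h ∈ Finset.range H,
    if O.state t h ω = s ∧ O.action t h ω = a then Y t h ω else 0) / visitCount H O k ω s a

theorem empMean_mem_Icc {Y : ℕ → ℕ → Ω → ℝ} {ω : Ω}
    (hY : ∀ t, 1 ≤ t → ∀ h < H, Y t h ω ∈ Set.Icc (0 : ℝ) 1) (k : ℕ) (s : S) (a : A) :
    empMean H O Y k ω s a ∈ Set.Icc (0 : ℝ) 1 := by
  have hN := zero_lt_one.trans_le (one_le_visitCount H O k ω s a)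
  constructor
  · refine div_nonneg (Finset.sum_nonneg fun t ht => Finset.sum_nonneg fun h hh => ?_) hN.le
    split_ifs
    · exact (hY t (Finset.mem_Ico.mp ht).1 h (Finset.mem_range.mp hh)).1
    · exact le_rfl
  · refine (div_le_one hN).mpr (le_trans (Finset.sum_le_sum fun t ht =>
      Finset.sum_le_sum fun h hh => ?_) (le_max_right _ _))
    split_ifs
    · exact (hY t (Finset.mem_Ico.mp ht).1 h (Finset.mem_range.mp hh)).2
    · exact le_rfl

/-- The estimation error of the mean `m` of `Y` plus a function `V` of the next state. -/
theorem measure_abs_estimation_error_ge_le [IsProbabilityMeasure μ]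
    (hFP : FollowsProtocol μ ℱ H s₀ M π O) (s : S) (a : A) (Y : ℕ → ℕ → Ω → ℝ) (V : S → ℝ)
    {lo B mean : ℝ} (hB : 0 < B)
    (hmean : mean + ∑ s', M.p s a s' * V s' ∈ Set.Icc lo (lo + B))
    (hY : ∀ t, 1 ≤ t → ∀ h < H, Measurable[ℱ (preTime H t (h + 1))] (Y t h))
    (hYint : ∀ t, 1 ≤ t → ∀ h < H, Integrable (Y t h) μ)
    (hYmem : ∀ t, 1 ≤ t → ∀ h < H, ∀ᵐ ω ∂μ,
      Y t h ω + V (O.state t (h + 1) ω) ∈ Set.Icc lo (lo + B))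
    (hcond : ∀ t, 1 ≤ t → ∀ h < H, ∀ E, MeasurableSet[ℱ (postTime H t h)] E →
      E ⊆ visitEvent O t h s a → ∫ ω in E, Y t h ω ∂μ = mean * μ.real E)
    (k : ℕ) {x : ℝ} (hx : 0 ≤ x) :
    μ {ω | 1 ≤ rawCount H O k ω s a ∧ B * √(x / (2 * rawCount H O k ω s a)) ≤
      |empMean H O Y k ω s a - mean +
        ∑ s', (empTransition H O k ω s a s' - M.p s a s') * V s'|} ≤
      ENNReal.ofReal (2 * (k * H) * Real.exp (-x)) := by
  have hstate : ∀ t, 1 ≤ t → ∀ h < H, ∀ s',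
      MeasurableSet[ℱ (preTime H t (h + 1))] {ω | O.state t (h + 1) ω = s'} :=
    fun t ht h hh => hFP.measurable_state t ht (h + 1) hh
  have hVint : ∀ t, 1 ≤ t → ∀ h < H, ∀ s', Integrable
      (fun ω => if O.state t (h + 1) ω = s' then (1 : ℝ) else 0) μ := fun t ht h hh s' =>
    integrable_one_ite (ℱ.le _ _ (hstate t ht h hh s'))
  have hVsum : ∀ t h, (fun ω => V (O.state t (h + 1) ω)) = fun ω =>
      ∑ s', (if O.state t (h + 1) ω = s' then (1 : ℝ) else 0) * V s' := fun t h => by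
    ext ω; simp
  refine le_trans (measure_mono ?_) (measure_abs_sum_visits_ge_le hFP s a
    (fun t h ω => Y t h ω + V (O.state t (h + 1) ω)) hB hmean
    (fun t ht h hh => (hY t ht h hh).add (measurable_comp_of_finite (hstate t ht h hh) V))
    hYmem ?_ k hx)
  · rintro ω ⟨h1, h2⟩
    refine ⟨h1, ?_⟩
    set C := rawCount H O k ω s a with hC
    have hC0 : 0 < C := zero_lt_one.trans_le h1
    have hN : visitCount H O k ω s a = C := by rw [visitCount_eq_max, max_eq_right h1]
    -- Multiplication by the count turns the estimation error into the sum of the centered variables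
    -- "outcome plus `V` of the next state" over the visits.
    have hid : ∑ t ∈ Finset.Ico 1 k, ∑ h ∈ Finset.range H, (visitEvent O t h s a).indicator
        (fun ω => Y t h ω + V (O.state t (h + 1) ω) - (mean + ∑ s', M.p s a s' * V s')) ω =
        C * (empMean H O Y k ω s a - mean +
          ∑ s', (empTransition H O k ω s a s' - M.p s a s') * V s') := by
      simp only [sub_mul, Finset.sum_sub_distrib]
      rw [sum_empTransition_mul, empMean, hN]
      have : ∀ x y z w : ℝ, C * (x / C - y + (z / C - w)) = x + z - C * (y + w) := by
        intros; field_simp; ring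
      rw [this, hC, rawCount]
      simp only [Finset.sum_mul, ← Finset.sum_add_distrib, ← Finset.sum_sub_distrib]
      refine Finset.sum_congr rfl fun t _ => Finset.sum_congr rfl fun h _ => ?_
      by_cases hω : ω ∈ visitEvent O t h s a
      · have := mem_visitEvent.mp hω
        simp [hω, this]
      · have := mt mem_visitEvent.mpr hω
        simp [hω, this]
    rw [hid, abs_mul, abs_of_pos hC0]
    refine le_trans (le_of_eq ?_) (mul_le_mul_of_nonneg_left h2 hC0.le)
    rw [show C * x / 2 = C ^ 2 * (x / (2 * C)) by field_simp,
      Real.sqrt_mul (sq_nonneg C), Real.sqrt_sq hC0.le]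
    ring
  · intro t ht h hh E hE hEv
    have hEm := ℱ.le _ _ hE
    have hVE : ∫ ω in E, V (O.state t (h + 1) ω) ∂μ = (∑ s', M.p s a s' * V s') * μ.real E := by
      rw [hVsum, integral_finsetSum _ fun s' _ =>
        ((hVint t ht h hh s').mul_const (V s')).integrableOn, Finset.sum_mul]
      refine Finset.sum_congr rfl fun s' _ => ?_
      rw [integral_mul_const, setIntegral_eq_const_mul_of_condExp (ℱ.le _) (hVint t ht h hh s')
        (hFP.state_law t ht h hh s') hE (c := M.p s a s')]
      · ring
      · intro ω hω
        have := mem_visitEvent.mp (hEv hω)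
        rw [this.1, this.2]
    rw [integral_add (hYint t ht h hh).integrableOn, hcond t ht h hh E hE hEv, hVE]
    · ring
    · rw [hVsum]
      exact (integrable_finsetSum _ fun s' _ => (hVint t ht h hh s').mul_const (V s')).integrableOn

/-- The reward (`none`) and the consumptions, as a single family. -/
def Observations.outcome (O : Observations S A ι Ω) : Option ι → ℕ → ℕ → Ω → ℝ
  | none => O.reward
  | some i => fun t h => O.consumption t h i

/-- The mean reward (`none`) and the mean consumptions, as a single family. -/
def CMDP.mean (M : CMDP S A ι) : Option ι → S → A → ℝ
  | none => M.r
  | some i => fun s a => M.c s a i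

theorem CMDP.IsProper.mean_mem (hM : M.IsProper) (o : Option ι) (s : S) (a : A) :
    M.mean o s a ∈ Set.Icc (0 : ℝ) 1 := by
  cases o with
  | none => exact hM.r_mem s a
  | some i => exact hM.c_mem s a i

theorem FollowsProtocol.measurable_outcome (hFP : FollowsProtocol μ ℱ H s₀ M π O) (o : Option ι)
    {t h : ℕ} (ht : 1 ≤ t) (hh : h < H) :
    Measurable[ℱ (preTime H t (h + 1))] (O.outcome o t h) := by
  cases o with
  | none => exact hFP.measurable_reward t ht h hh
  | some i => exact hFP.measurable_consumption t ht h hh i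

theorem FollowsProtocol.outcome_mem (hFP : FollowsProtocol μ ℱ H s₀ M π O) (o : Option ι)
    {t h : ℕ} (ht : 1 ≤ t) (hh : h < H) : ∀ᵐ ω ∂μ, O.outcome o t h ω ∈ Set.Icc (0 : ℝ) 1 := by
  cases o with
  | none => exact hFP.reward_mem t ht h hh
  | some i => exact hFP.consumption_mem t ht h hh i

theorem FollowsProtocol.outcome_mean (hFP : FollowsProtocol μ ℱ H s₀ M π O) (o : Option ι)
    {t h : ℕ} (ht : 1 ≤ t) (hh : h < H) : μ[O.outcome o t h | ℱ (postTime H t h)]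
      =ᵐ[μ] fun ω => M.mean o (O.state t h ω) (O.action t h ω) := by
  cases o with
  | none => exact hFP.reward_mean t ht h hh
  | some i => exact hFP.consumption_mean t ht h hh i

/-- The empirical mean of an outcome plus the value of the next state under a fixed policy is close
to its mean. -/
theorem measure_abs_bellman_error_ge_le [IsProbabilityMeasure μ] (hM : M.IsProper)
    (hFP : FollowsProtocol μ ℱ H s₀ M π O) {π' : Policy S A} (hπ' : IsPolicy H π') (s : S) (a : A)
    (o : Option ι) {h' : ℕ} (hh' : h' < H) (k : ℕ) {x : ℝ} (hx : 0 ≤ x) :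
    μ {ω | 1 ≤ rawCount H O k ω s a ∧ H * √(x / (2 * rawCount H O k ω s a)) ≤
      |empMean H O (O.outcome o) k ω s a - M.mean o s a +
        ∑ s', (empTransition H O k ω s a s' - M.p s a s') *
          valueFn H π' M.p (M.mean o) (h' + 1) s'|} ≤
      ENNReal.ofReal (2 * (k * H) * Real.exp (-x)) := by
  -- At least one step is already spent, so the outcome plus the continuation value has range `H`.
  have hV : ∀ s', valueFn H π' M.p (M.mean o) (h' + 1) s' ∈ Set.Icc (0 : ℝ) ((H : ℝ) - 1) := by
    intro s'
    have h := valueFn_mem_Icc hπ' hM.p_mem (hM.mean_mem o) (Nat.succ_le_of_lt hh') s'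
    refine ⟨h.1, h.2.trans ?_⟩
    have : H - (h' + 1) + 1 ≤ H := by omega
    have : ((H - (h' + 1) : ℕ) : ℝ) + 1 ≤ H := by exact_mod_cast this
    linarith
  have hint : ∀ t, 1 ≤ t → ∀ h < H, Integrable (O.outcome o t h) μ := fun t ht h hh =>
    Integrable.of_mem_Icc _ _ ((hFP.measurable_outcome o ht hh).mono (ℱ.le _) le_rfl).aemeasurable
      (hFP.outcome_mem o ht hh)
  refine measure_abs_estimation_error_ge_le (lo := 0) hFP s a (O.outcome o) _
    (by exact_mod_cast (by omega : 0 < H)) ?_ (fun t ht h hh => hFP.measurable_outcome o ht hh)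
    hint ?_ ?_ k hx
  · have h1 := sum_mul_mem_Icc_of_mem_stdSimplex (hM.p_mem s a) hV
    have h2 := hM.mean_mem o s a
    exact ⟨by linarith [h1.1, h2.1], by linarith [h1.2, h2.2]⟩
  · intro t ht h hh
    filter_upwards [hFP.outcome_mem o ht hh] with ω hω
    have h1 := hV (O.state t (h + 1) ω)
    exact ⟨by linarith [h1.1, hω.1], by linarith [h1.2, hω.2]⟩
  · intro t ht h hh E hE hEv
    refine setIntegral_eq_const_mul_of_condExp (ℱ.le _) (hint t ht h hh)
      (hFP.outcome_mean o ht hh) hE fun ω hω => ?_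
    have := mem_visitEvent.mp (hEv hω)
    rw [this.1, this.2]

/-- Total variation is attained at one of finitely many sign patterns, each of which is a fixed test
function to which Hoeffding's inequality applies. -/
theorem exists_sign_sum_abs_eq (f : S → ℝ) :
    ∃ σ : S → Bool, ∑ s, |f s| = ∑ s, f s * (if σ s then 1 else -1) := by
  refine ⟨fun s => decide (0 ≤ f s), Finset.sum_congr rfl fun s _ => ?_⟩
  by_cases h : 0 ≤ f s
  · simp [h, abs_of_nonneg]
  · simp [h, abs_of_neg (not_le.mp h)]

/-- The empirical transition probabilities are close to the true ones in total variation. -/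
theorem measure_sum_abs_empTransition_sub_ge_le [IsProbabilityMeasure μ] (hM : M.IsProper)
    (hFP : FollowsProtocol μ ℱ H s₀ M π O) (s : S) (a : A) (k : ℕ) {x : ℝ} (hx : 0 ≤ x) :
    μ {ω | 1 ≤ rawCount H O k ω s a ∧ 2 * √(x / (2 * rawCount H O k ω s a)) ≤
      ∑ s', |empTransition H O k ω s a s' - M.p s a s'|} ≤
      2 ^ Fintype.card S * ENNReal.ofReal (2 * (k * H) * Real.exp (-x)) := by
  have hσ : ∀ (σ : S → Bool) s', (if σ s' then (1 : ℝ) else -1) ∈ Set.Icc (-1 : ℝ) (-1 + 2) := by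
    intro σ s'; split_ifs <;> norm_num
  have h0 : ∀ ω, empMean H O (fun _ _ _ => 0) k ω s a = 0 := by simp [empMean]
  have hone : ∀ σ : S → Bool, μ {ω | 1 ≤ rawCount H O k ω s a ∧
      2 * √(x / (2 * rawCount H O k ω s a)) ≤ |empMean H O (fun _ _ _ => 0) k ω s a - 0 +
        ∑ s', (empTransition H O k ω s a s' - M.p s a s') * (if σ s' then 1 else -1)|} ≤
      ENNReal.ofReal (2 * (k * H) * Real.exp (-x)) := fun σ =>
    measure_abs_estimation_error_ge_le (lo := -1) hFP s a (fun _ _ _ => 0) _ two_pos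
      (by simpa using sum_mul_mem_Icc_of_mem_stdSimplex (hM.p_mem s a) (hσ σ))
      (fun _ _ _ _ => measurable_const) (fun _ _ _ _ => integrable_zero _ _ _)
      (fun t _ h _ => Filter.Eventually.of_forall fun ω => by simpa using hσ σ _)
      (fun _ _ _ _ _ _ _ => by simp) k hx
  calc _ ≤ μ (⋃ σ : S → Bool, {ω | 1 ≤ rawCount H O k ω s a ∧
      2 * √(x / (2 * rawCount H O k ω s a)) ≤ |empMean H O (fun _ _ _ => 0) k ω s a - 0 +
        ∑ s', (empTransition H O k ω s a s' - M.p s a s') * (if σ s' then 1 else -1)|}) := by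
        refine measure_mono ?_
        rintro ω ⟨h1, h2⟩
        obtain ⟨σ, h3⟩ := exists_sign_sum_abs_eq fun s' => empTransition H O k ω s a s' - M.p s a s'
        refine Set.mem_iUnion.mpr ⟨σ, h1, ?_⟩
        rw [h0, sub_zero, zero_add, ← h3]
        exact h2.trans (le_abs_self _)
    _ ≤ ∑ σ : S → Bool, ENNReal.ofReal (2 * (k * H) * Real.exp (-x)) :=
        (measure_iUnion_fintype_le _ _).trans (Finset.sum_le_sum fun σ _ => hone σ)
    _ = _ := by simp

end Estimation

/-! ### Realized trajectories against the computed state laws. -/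

section Occupancy

set_option linter.unusedSectionVars false

variable {S A ι Ω : Type*} [Fintype S] [DecidableEq S] [Fintype A] [DecidableEq A]
  [mΩ : MeasurableSpace Ω] {μ : Measure Ω} {ℱ : Filtration ℕ mΩ}
  {H : ℕ} {s₀ : S} {M : CMDP S A ι} {π : ℕ → Ω → Policy S A} {O : Observations S A ι Ω}

theorem measurable_stateProb (hFP : FollowsProtocol μ ℱ H s₀ M π O) {t : ℕ} (ht : 1 ≤ t) {h : ℕ}
    (hh : h ≤ H) (s : S) :
    Measurable[ℱ (preTime H t 0)] fun ω => stateProb s₀ (π t ω) M.p h s := by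
  induction h generalizing s with
  | zero => exact measurable_const
  | succ h ih =>
    simp only [stateProb]
    exact Finset.measurable_sum _ fun x _ => Finset.measurable_sum _ fun a _ =>
      ((ih (by omega) x).mul (hFP.measurable_policy t ht h hh x a)).mul_const _

theorem stateProb_mul_policy_mem_Icc (hM : M.IsProper) {π' : Policy S A} (hπ' : IsPolicy H π')
    {h : ℕ} (hh : h < H) (s : S) (a : A) :
    stateProb s₀ π' M.p h s * π' h s a ∈ Set.Icc (0 : ℝ) 1 := by
  have hp := fun s a => (hM.p_mem s a).1
  have h0 := stateProb_nonneg (s₀ := s₀) hπ' hp hh.le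
  have h1 : stateProb s₀ π' M.p h s ≤ 1 := (sum_stateProb hπ' hM.p_mem hh.le) ▸
    Finset.single_le_sum (fun x _ => h0 x) (Finset.mem_univ s)
  have h2 := (hπ' h hh s).1 a
  have h3 : π' h s a ≤ 1 := (hπ' h hh s).2 ▸
    Finset.single_le_sum (fun x _ => (hπ' h hh s).1 x) (Finset.mem_univ a)
  exact ⟨mul_nonneg (h0 s) h2, mul_le_one₀ h1 h2 h3⟩

/-- Conditioning on the start of the episode is expressed by testing against bounded weights `W`
known at that time. The action law produces the factor `π t ω h s a`; as the policy is committed to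
in advance, this factor joins the weight before `ih` is applied. -/
theorem integral_mul_visit_of_state [IsProbabilityMeasure μ]
    (hFP : FollowsProtocol μ ℱ H s₀ M π O) {t : ℕ} (ht : 1 ≤ t) {h : ℕ} (hh : h < H)
    (ih : ∀ s (W : Ω → ℝ), Measurable[ℱ (preTime H t 0)] W → (∃ C, ∀ ω, |W ω| ≤ C) →
      ∫ ω, W ω * (if O.state t h ω = s then 1 else 0) ∂μ =
        ∫ ω, W ω * stateProb s₀ (π t ω) M.p h s ∂μ)
    (s : S) (a : A) (W : Ω → ℝ) (hW : Measurable[ℱ (preTime H t 0)] W)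
    (hWb : ∃ C, ∀ ω, |W ω| ≤ C) :
    ∫ ω, W ω * (if O.state t h ω = s ∧ O.action t h ω = a then 1 else 0) ∂μ =
      ∫ ω, W ω * (stateProb s₀ (π t ω) M.p h s * π t ω h s a) ∂μ := by
  obtain ⟨C, hC⟩ := hWb
  have hpi : ∀ ω, |π t ω h s a| ≤ 1 := fun ω => by
    have h1 := hFP.isPolicy t ht ω h hh s
    rw [abs_of_nonneg (h1.1 a), ← h1.2]
    exact Finset.single_le_sum (fun x _ => h1.1 x) (Finset.mem_univ a)
  have hpre : Measurable[ℱ (preTime H t h)] W :=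
    hW.mono (ℱ.mono (preTime_mono H t (Nat.zero_le h))) le_rfl
  have hs := hFP.measurable_state t ht h hh.le s
  have hWs : Measurable[ℱ (preTime H t h)]
      fun ω => W ω * (if O.state t h ω = s then 1 else 0) := hpre.mul (measurable_one_ite hs)
  have hact : MeasurableSet {ω | O.action t h ω = a} :=
    ℱ.le _ _ (hFP.measurable_action t ht h hh a)
  calc _ = ∫ ω, (W ω * (if O.state t h ω = s then 1 else 0)) *
        (if O.action t h ω = a then 1 else 0) ∂μ := by
        refine integral_congr_ae (Filter.Eventually.of_forall fun ω => ?_)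
        by_cases h1 : O.state t h ω = s <;> by_cases h2 : O.action t h ω = a <;> simp [h1, h2]
    _ = ∫ ω, (W ω * (if O.state t h ω = s then 1 else 0)) * π t ω h (O.state t h ω) a ∂μ :=
        integral_mul_eq_of_condExp (ℱ.le _) (integrable_one_ite hact)
          (hFP.action_law t ht h hh a) hWs ⟨C, fun ω => by
            split_ifs
            · simpa using hC ω
            · simpa using (abs_nonneg _).trans (hC ω)⟩
    _ = ∫ ω, (W ω * π t ω h s a) * (if O.state t h ω = s then 1 else 0) ∂μ := by
        refine integral_congr_ae (Filter.Eventually.of_forall fun ω => ?_)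
        by_cases h1 : O.state t h ω = s <;> simp [h1]
    _ = ∫ ω, (W ω * π t ω h s a) * stateProb s₀ (π t ω) M.p h s ∂μ :=
        ih s _ (hW.mul (hFP.measurable_policy t ht h hh s a)) ⟨C, fun ω => by
          rw [abs_mul]
          exact (mul_le_of_le_one_right (abs_nonneg _) (hpi ω)).trans (hC ω)⟩
    _ = _ := integral_congr_ae (Filter.Eventually.of_forall fun ω => by ring)

theorem integrable_mul_of_mem_Icc [IsProbabilityMeasure μ] {W f : Ω → ℝ} (hW : Measurable W)
    (hWb : ∃ C, ∀ ω, |W ω| ≤ C) (hf : Measurable f) (hfb : ∀ ω, f ω ∈ Set.Icc (0 : ℝ) 1) :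
    Integrable (fun ω => W ω * f ω) μ := by
  obtain ⟨C, hC⟩ := hWb
  refine Integrable.of_bound (hW.mul hf).aestronglyMeasurable C
    (Filter.Eventually.of_forall fun ω => ?_)
  rw [Real.norm_eq_abs, abs_mul, abs_of_nonneg (hfb ω).1]
  exact (mul_le_of_le_one_right (abs_nonneg _) (hfb ω).2).trans (hC ω)

theorem one_ite_mem_Icc (p : Prop) [Decidable p] :
    (if p then (1 : ℝ) else 0) ∈ Set.Icc (0 : ℝ) 1 := by
  split_ifs <;> norm_num

/-- Given the past of an episode, `stateProb` is the law of its states. -/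
theorem integral_mul_state [IsProbabilityMeasure μ] (hM : M.IsProper)
    (hFP : FollowsProtocol μ ℱ H s₀ M π O) {t : ℕ} (ht : 1 ≤ t) {h : ℕ} (hh : h ≤ H) (s : S)
    (W : Ω → ℝ) (hW : Measurable[ℱ (preTime H t 0)] W) (hWb : ∃ C, ∀ ω, |W ω| ≤ C) :
    ∫ ω, W ω * (if O.state t h ω = s then 1 else 0) ∂μ =
      ∫ ω, W ω * stateProb s₀ (π t ω) M.p h s ∂μ := by
  induction h generalizing s W with
  | zero => simp [stateProb, hFP.state_zero t ht, eq_comm]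
  | succ h ih =>
    have hh : h < H := hh
    have hW' := hW.mono (ℱ.le _) le_rfl
    have hvisit : ∀ x a, MeasurableSet[ℱ (postTime H t h)]
        {ω | O.state t h ω = x ∧ O.action t h ω = a} := measurableSet_visitEvent hFP ht hh
    have hs : MeasurableSet {ω | O.state t (h + 1) ω = s} :=
      ℱ.le _ _ (hFP.measurable_state t ht (h + 1) hh s)
    have hWpost : Measurable[ℱ (postTime H t h)] W := hW.mono (ℱ.mono
      ((preTime_mono H t (Nat.zero_le h)).trans (preTime_le_postTime H t h))) le_rfl
    obtain ⟨C, hC⟩ := hWb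
    have hb : ∀ x a, ∃ C, ∀ ω,
        |W ω * (if O.state t h ω = x ∧ O.action t h ω = a then 1 else 0)| ≤ C :=
      fun x a => ⟨C, fun ω => by
        rw [abs_mul, abs_of_nonneg (one_ite_mem_Icc _).1]
        exact (mul_le_of_le_one_right (abs_nonneg _) (one_ite_mem_Icc _).2).trans (hC ω)⟩
    have hWv : ∀ x a, Measurable[ℱ (postTime H t h)] fun ω =>
        W ω * (if O.state t h ω = x ∧ O.action t h ω = a then 1 else 0) :=
      fun x a => hWpost.mul (measurable_one_ite (hvisit x a))
    have hmP : ∀ x a, Measurable fun ω => stateProb s₀ (π t ω) M.p h x * π t ω h x a :=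
      fun x a => ((measurable_stateProb hFP ht hh.le x).mul
        (hFP.measurable_policy t ht h hh x a)).mono (ℱ.le _) le_rfl
    calc ∫ ω, W ω * (if O.state t (h + 1) ω = s then 1 else 0) ∂μ
        = ∫ ω, ∑ x, ∑ a, (W ω * (if O.state t h ω = x ∧ O.action t h ω = a then 1 else 0)) *
            (if O.state t (h + 1) ω = s then 1 else 0) ∂μ := by
          refine integral_congr_ae (Filter.Eventually.of_forall fun ω => ?_)
          simp only [← Finset.sum_mul, ← Finset.mul_sum]
          congr 1
          rw [Finset.sum_eq_single (O.state t h ω), Finset.sum_eq_single (O.action t h ω)] <;>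
            simp +contextual [eq_comm]
      _ = ∑ x, ∑ a, ∫ ω, (W ω * (if O.state t h ω = x ∧ O.action t h ω = a then 1 else 0)) *
            (if O.state t (h + 1) ω = s then 1 else 0) ∂μ := by
          have hi : ∀ x a, Integrable (fun ω =>
              (W ω * (if O.state t h ω = x ∧ O.action t h ω = a then 1 else 0)) *
              (if O.state t (h + 1) ω = s then (1 : ℝ) else 0)) μ := fun x a =>
            integrable_mul_of_mem_Icc ((hWv x a).mono (ℱ.le _) le_rfl) (hb x a)
              (measurable_one_ite hs) fun ω => one_ite_mem_Icc _
          rw [integral_finsetSum _ fun x _ => integrable_finsetSum _ fun a _ => hi x a]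
          exact Finset.sum_congr rfl fun x _ => integral_finsetSum _ fun a _ => hi x a
      -- The next state is integrated out at the post-action time, which leaves the constant `M.p x
      -- a s`; then the visit is integrated out.
      _ = ∑ x, ∑ a, ∫ ω, W ω * (stateProb s₀ (π t ω) M.p h x * π t ω h x a) * M.p x a s ∂μ := by
          refine Finset.sum_congr rfl fun x _ => Finset.sum_congr rfl fun a _ => ?_
          rw [integral_mul_eq_of_condExp (ℱ.le _) (integrable_one_ite hs)
            (hFP.state_law t ht h hh s) (hWv x a) (hb x a), integral_mul_const,
            ← integral_mul_visit_of_state hFP ht hh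
              (fun s W hW hWb => ih hh.le s W hW hWb) x a W hW ⟨C, hC⟩, ← integral_mul_const]
          refine integral_congr_ae (Filter.Eventually.of_forall fun ω => ?_)
          by_cases h1 : O.state t h ω = x ∧ O.action t h ω = a
          · simp [h1]
          · simp [h1]
      _ = _ := by
          have hi : ∀ x a, Integrable (fun ω =>
              W ω * (stateProb s₀ (π t ω) M.p h x * π t ω h x a) * M.p x a s) μ := fun x a =>
            (integrable_mul_of_mem_Icc hW' ⟨C, hC⟩ (hmP x a) fun ω =>
              stateProb_mul_policy_mem_Icc hM (hFP.isPolicy t ht ω) hh x a).mul_const _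
          simp_rw [← integral_finsetSum _ fun a _ => hi _ a]
          rw [← integral_finsetSum _ fun x _ => integrable_finsetSum _ fun a _ => hi x a]
          refine integral_congr_ae (Filter.Eventually.of_forall fun ω => ?_)
          simp only [stateProb, Finset.mul_sum]
          exact Finset.sum_congr rfl fun x _ => Finset.sum_congr rfl fun a _ => by ring

/-- Given the past of an episode, `expTotal` is the conditional expectation of the total. -/
theorem integral_mul_total [IsProbabilityMeasure μ] (hM : M.IsProper)
    (hFP : FollowsProtocol μ ℱ H s₀ M π O) {t : ℕ} (ht : 1 ≤ t) (g : Ω → S → A → ℝ)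
    (hg : ∀ s a, Measurable[ℱ (preTime H t 0)] fun ω => g ω s a)
    (hgb : ∀ ω s a, g ω s a ∈ Set.Icc (0 : ℝ) 1)
    (W : Ω → ℝ) (hW : Measurable[ℱ (preTime H t 0)] W) (hWb : ∃ C, ∀ ω, |W ω| ≤ C) :
    ∫ ω, W ω * ∑ h ∈ Finset.range H, g ω (O.state t h ω) (O.action t h ω) ∂μ =
      ∫ ω, W ω * expTotal H s₀ (π t ω) M.p (g ω) ∂μ := by
  have hWg : ∀ s a, Measurable[ℱ (preTime H t 0)] fun ω => W ω * g ω s a :=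
    fun s a => hW.mul (hg s a)
  have hWg' : ∀ s a, Measurable fun ω => W ω * g ω s a :=
    fun s a => (hWg s a).mono (ℱ.le _) le_rfl
  have hWgb : ∀ s a, ∃ C, ∀ ω, |W ω * g ω s a| ≤ C := fun s a => by
    obtain ⟨C, hC⟩ := hWb
    refine ⟨C, fun ω => ?_⟩
    rw [abs_mul, abs_of_nonneg (hgb ω s a).1]
    exact (mul_le_of_le_one_right (abs_nonneg _) (hgb ω s a).2).trans (hC ω)
  have hi1 : ∀ h ∈ Finset.range H, ∀ s a, Integrable (fun ω => (W ω * g ω s a) *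
      (if O.state t h ω = s ∧ O.action t h ω = a then (1 : ℝ) else 0)) μ := fun h hh s a =>
    integrable_mul_of_mem_Icc (hWg' s a) (hWgb s a) (measurable_one_ite (ℱ.le _ _
      (measurableSet_visitEvent hFP ht (Finset.mem_range.mp hh) s a))) fun ω => one_ite_mem_Icc _
  have hi2 : ∀ h ∈ Finset.range H, ∀ s a, Integrable (fun ω => (W ω * g ω s a) *
      (stateProb s₀ (π t ω) M.p h s * π t ω h s a)) μ := fun h hh s a =>
    integrable_mul_of_mem_Icc (hWg' s a) (hWgb s a)
      (((measurable_stateProb hFP ht (Finset.mem_range.mp hh).le s).mul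
        (hFP.measurable_policy t ht h (Finset.mem_range.mp hh) s a)).mono (ℱ.le _) le_rfl) fun ω =>
      stateProb_mul_policy_mem_Icc hM (hFP.isPolicy t ht ω) (Finset.mem_range.mp hh) s a
  have e1 : ∀ ω, W ω * ∑ h ∈ Finset.range H, g ω (O.state t h ω) (O.action t h ω) =
      ∑ h ∈ Finset.range H, ∑ s, ∑ a, (W ω * g ω s a) *
        (if O.state t h ω = s ∧ O.action t h ω = a then (1 : ℝ) else 0) := fun ω => by
    rw [Finset.mul_sum]
    refine Finset.sum_congr rfl fun h _ => ?_
    rw [Finset.sum_eq_single (O.state t h ω), Finset.sum_eq_single (O.action t h ω)] <;>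
      simp +contextual [eq_comm]
  have e2 : ∀ ω, W ω * expTotal H s₀ (π t ω) M.p (g ω) =
      ∑ h ∈ Finset.range H, ∑ s, ∑ a, (W ω * g ω s a) *
        (stateProb s₀ (π t ω) M.p h s * π t ω h s a) := fun ω => by
    simp only [expTotal, Finset.mul_sum]
    exact Finset.sum_congr rfl fun h _ => Finset.sum_congr rfl fun s _ =>
      Finset.sum_congr rfl fun a _ => by ring
  simp_rw [e1, e2]
  rw [integral_finsetSum _ fun h hh => integrable_finsetSum _ fun s _ =>
      integrable_finsetSum _ fun a _ => hi1 h hh s a,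
    integral_finsetSum _ fun h hh => integrable_finsetSum _ fun s _ =>
      integrable_finsetSum _ fun a _ => hi2 h hh s a]
  refine Finset.sum_congr rfl fun h hh => ?_
  rw [integral_finsetSum _ fun s _ => integrable_finsetSum _ fun a _ => hi1 h hh s a,
    integral_finsetSum _ fun s _ => integrable_finsetSum _ fun a _ => hi2 h hh s a]
  refine Finset.sum_congr rfl fun s _ => ?_
  rw [integral_finsetSum _ fun a _ => hi1 h hh s a, integral_finsetSum _ fun a _ => hi2 h hh s a]
  refine Finset.sum_congr rfl fun a _ => ?_
  have hh := Finset.mem_range.mp hh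
  exact integral_mul_visit_of_state hFP ht hh
    (fun s W hW hWb => integral_mul_state hM hFP ht hh.le s W hW hWb) s a _ (hWg s a) (hWgb s a)

theorem measurable_expTotal (hFP : FollowsProtocol μ ℱ H s₀ M π O) {t : ℕ} (ht : 1 ≤ t)
    {g : Ω → S → A → ℝ} (hg : ∀ s a, Measurable[ℱ (preTime H t 0)] fun ω => g ω s a) :
    Measurable[ℱ (preTime H t 0)] fun ω => expTotal H s₀ (π t ω) M.p (g ω) := by
  refine Finset.measurable_sum _ fun h hh => Finset.measurable_sum _ fun s _ =>
    Finset.measurable_sum _ fun a _ => ?_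
  have hh := Finset.mem_range.mp hh
  exact ((measurable_stateProb hFP ht hh.le s).mul (hFP.measurable_policy t ht h hh s a)).mul
    (hg s a)

theorem measurable_total (hFP : FollowsProtocol μ ℱ H s₀ M π O) {t : ℕ} (ht : 1 ≤ t)
    {g : Ω → S → A → ℝ} (hg : ∀ s a, Measurable[ℱ (preTime H t 0)] fun ω => g ω s a) :
    Measurable[ℱ (preTime H (t + 1) 0)] fun ω =>
      ∑ h ∈ Finset.range H, g ω (O.state t h ω) (O.action t h ω) := by
  refine Finset.measurable_sum _ fun h hh => ?_
  have hh := Finset.mem_range.mp hh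
  have e : (fun ω => g ω (O.state t h ω) (O.action t h ω)) = fun ω => ∑ s, ∑ a, g ω s a *
      (if O.state t h ω = s ∧ O.action t h ω = a then (1 : ℝ) else 0) := by
    ext ω
    rw [Finset.sum_eq_single (O.state t h ω), Finset.sum_eq_single (O.action t h ω)] <;>
      simp +contextual [eq_comm]
  rw [e]
  refine Finset.measurable_sum _ fun s _ => Finset.measurable_sum _ fun a _ => ?_
  refine ((hg s a).mono (ℱ.mono (preTime_zero_mono H (Nat.le_succ t))) le_rfl).mul
    (measurable_one_ite (ℱ.mono ((postTime_le_preTime_succ H t h).trans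
      (preTime_le_preTime_of_lt (Nat.lt_succ_self t) hh)) _
      (measurableSet_visitEvent hFP ht hh s a)))

/-- The expected totals of predictable weights are controlled by the realized ones. -/
theorem measure_sum_expTotal_ge_le [IsProbabilityMeasure μ] (hM : M.IsProper)
    (hFP : FollowsProtocol μ ℱ H s₀ M π O) (hH : 0 < H) (g : ℕ → Ω → S → A → ℝ)
    (hg : ∀ t, 1 ≤ t → ∀ s a, Measurable[ℱ (preTime H t 0)] fun ω => g t ω s a)
    (hgb : ∀ t ω s a, g t ω s a ∈ Set.Icc (0 : ℝ) 1) (k : ℕ) (x : ℝ) :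
    μ {ω | 2 * ∑ t ∈ Finset.Ico 1 k, ∑ h ∈ Finset.range H,
        g t ω (O.state t h ω) (O.action t h ω) + 2 * H * x ≤
        ∑ t ∈ Finset.Ico 1 k, expTotal H s₀ (π t ω) M.p (g t ω)} ≤
      ENNReal.ofReal (Real.exp (-x)) := by
  have hH' : (0 : ℝ) < H := by exact_mod_cast hH
  -- Totals are divided by `H` to lie in `[0, 1]`; undoing this gives the additive term `2 * H * x`.
  set X : ℕ → Ω → ℝ := fun t ω =>
    (∑ h ∈ Finset.range H, g t ω (O.state t h ω) (O.action t h ω)) / H with hX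
  set E : ℕ → Ω → ℝ := fun t ω => expTotal H s₀ (π t ω) M.p (g t ω) / H with hE
  have hXm : ∀ t, 1 ≤ t → Measurable[ℱ (preTime H (t + 1) 0)] (X t) := fun t ht =>
    (measurable_total hFP ht (hg t ht)).div_const _
  have hEm : ∀ t, 1 ≤ t → Measurable[ℱ (preTime H t 0)] (E t) := fun t ht =>
    (measurable_expTotal hFP ht (hg t ht)).div_const _
  have hm : ∀ t, 1 ≤ t → Measurable[ℱ (preTime H (t + 1) 0)] fun ω => E t ω / 2 - X t ω :=
    fun t ht => (((hEm t ht).mono (ℱ.mono (preTime_zero_mono H (Nat.le_succ t)))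
      le_rfl).div_const 2).sub (hXm t ht)
  have hcontr := isExpContraction_sum_episodes (μ := μ) (ℱ := ℱ) (H := H)
    (fun t ω => E t ω / 2 - X t ω) k hm (fun t ht => by
      refine isExpContraction_half_sub (ℱ.le _) ((hXm t ht).mono (ℱ.le _) le_rfl) (hEm t ht)
        (fun ω => ?_) (fun ω => ?_) fun W hW hWb => ?_
      · refine ⟨div_nonneg (Finset.sum_nonneg fun h _ => (hgb t ω _ _).1) hH'.le,
          (div_le_one hH').mpr ?_⟩
        calc _ ≤ ∑ h ∈ Finset.range H, (1 : ℝ) := Finset.sum_le_sum fun h _ => (hgb t ω _ _).2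
          _ = H := by simp
      · have := expTotal_mem_Icc (s₀ := s₀) (hFP.isPolicy t ht ω) hM.p_mem (hgb t ω)
        exact ⟨div_nonneg this.1 hH'.le, (div_le_one hH').mpr this.2⟩
      · have := integral_mul_total hM hFP ht (g t) (hg t ht) (hgb t) W hW hWb
        simp only [hX, hE, ← mul_div_assoc]
        rw [integral_div, integral_div, this])
  have htail := hcontr.measure_ge_le (Finset.measurable_sum _ fun t ht =>
    (hm t (Finset.mem_Ico.mp ht).1).mono (ℱ.le _) le_rfl) x
  refine le_trans (measure_mono fun ω hω => ?_) htail
  change x ≤ ∑ t ∈ Finset.Ico 1 k, (E t ω / 2 - X t ω)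
  rw [Finset.sum_sub_distrib, ← Finset.sum_div]
  simp only [hX, hE]
  rw [← Finset.sum_div, ← Finset.sum_div, div_div, mul_comm (H : ℝ) 2, le_sub_iff_add_le,
    le_div_iff₀ (by positivity)]
  have : ∀ y : ℝ, (x + y / H) * (2 * H) = 2 * y + 2 * H * x := fun y => by field_simp; ring
  rw [this]
  exact hω

end Occupancy

/-! ### The logarithm of the bonus and the failure probabilities. -/

section LogTerm

/-- The logarithm in the bonus of episode `k`. -/
noncomputable def logTerm (S A d H : ℕ) (δ : ℝ) (k : ℕ) : ℝ :=
  Real.log (8 * S * A * H * (d + 1) * (k : ℝ) ^ 2 / δ)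

variable {S A d H k : ℕ} {δ : ℝ}

theorem one_le_natCast_mul (hS : 1 ≤ S) (hA : 1 ≤ A) (hH : 1 ≤ H) :
    (1 : ℝ) ≤ S * A * H * (d + 1) := by
  have : 1 ≤ S * A * H * (d + 1) :=
    Nat.one_le_iff_ne_zero.mpr (by positivity)
  exact_mod_cast this

theorem exp_neg_logTerm (hS : 1 ≤ S) (hA : 1 ≤ A) (hH : 1 ≤ H) (hk : 1 ≤ k) (hδ : 0 < δ) :
    Real.exp (-logTerm S A d H δ k) = δ / (8 * (S * A * H * (d + 1)) * (k : ℝ) ^ 2) := by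
  have hk' : (1 : ℝ) ≤ k := by exact_mod_cast hk
  have hP : (1 : ℝ) ≤ S * A * H * (d + 1) := one_le_natCast_mul hS hA hH
  have e : 8 * S * A * H * (d + 1) * (k : ℝ) ^ 2 / δ =
      8 * (S * A * H * (d + 1)) * (k : ℝ) ^ 2 / δ := by ring
  rw [logTerm, e, Real.exp_neg, Real.exp_log (by positivity), inv_div]

theorem one_le_logTerm (hS : 1 ≤ S) (hA : 1 ≤ A) (hH : 1 ≤ H) (hk : 1 ≤ k) (hδ : 0 < δ)
    (hδ1 : δ ≤ 1) : 1 ≤ logTerm S A d H δ k := by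
  have hk' : (1 : ℝ) ≤ k := by exact_mod_cast hk
  have hP : (1 : ℝ) ≤ S * A * H * (d + 1) := one_le_natCast_mul hS hA hH
  have hPk : (1 : ℝ) ≤ S * A * H * (d + 1) * (k : ℝ) ^ 2 :=
    one_le_mul_of_one_le_of_one_le hP (one_le_pow₀ hk')
  have h8 : 8 ≤ 8 * S * A * H * (d + 1) * (k : ℝ) ^ 2 / δ := by
    rw [le_div_iff₀ hδ]
    nlinarith
  rw [logTerm, Real.le_log_iff_exp_le (by linarith)]
  linarith [Real.exp_one_lt_d9]

theorem logTerm_mono (hS : 1 ≤ S) (hA : 1 ≤ A) (hH : 1 ≤ H) (hδ : 0 < δ) {t : ℕ} (ht : 1 ≤ t)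
    (htk : t ≤ k) : logTerm S A d H δ t ≤ logTerm S A d H δ k := by
  have ht' : (1 : ℝ) ≤ t := by exact_mod_cast ht
  have htk' : (t : ℝ) ≤ k := by exact_mod_cast htk
  have hS' : (1 : ℝ) ≤ S := by exact_mod_cast hS
  have hA' : (1 : ℝ) ≤ A := by exact_mod_cast hA
  have hH' : (1 : ℝ) ≤ H := by exact_mod_cast hH
  refine Real.log_le_log (by positivity) ?_
  gcongr

/-- The failure probabilities of all estimates of episode `k` sum up to at most `δ / k ^ 2`. -/
theorem failure_prob_le (hS : 1 ≤ S) (hA : 1 ≤ A) (hH : 1 ≤ H) (hk : 1 ≤ k) (hδ : 0 < δ)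
    (hδ1 : δ ≤ 1) :
    S * A * (d + 1) * H * (2 * (k * H) * Real.exp (-(4 * logTerm S A d H δ k))) +
      S * A * (2 ^ S * (2 * (k * H) * Real.exp (-(5 * S * logTerm S A d H δ k)))) +
      Real.exp (-logTerm S A d H δ k) ≤ δ * (1 / (k : ℝ) ^ 2) := by
  have hq := exp_neg_logTerm (d := d) hS hA hH hk hδ
  have hL := one_le_logTerm (d := d) hS hA hH hk hδ hδ1
  set L := logTerm S A d H δ k
  set q := Real.exp (-L) with hqdef
  have hk' : (1 : ℝ) ≤ k := by exact_mod_cast hk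
  have hS' : (1 : ℝ) ≤ S := by exact_mod_cast hS
  have hA' : (1 : ℝ) ≤ A := by exact_mod_cast hA
  have hH' : (1 : ℝ) ≤ H := by exact_mod_cast hH
  have hd' : (1 : ℝ) ≤ d + 1 := by linarith [(Nat.cast_nonneg d : (0 : ℝ) ≤ d)]
  have hq0 : 0 < q := Real.exp_pos _
  have hq4 : Real.exp (-(4 * L)) = q ^ 4 := by
    rw [hqdef, ← Real.exp_nat_mul]; congr 1; push_cast; ring
  -- The sign patterns cost at most `exp (S * L)`, one of the five multiples of `S * L` in the
  -- exponent.
  have h2S : (2 : ℝ) ^ S * Real.exp (-(5 * S * L)) ≤ q ^ 4 := by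
    have h2 : (2 : ℝ) ^ S ≤ Real.exp (S * L) := by
      rw [Real.exp_nat_mul]
      refine pow_le_pow_left₀ (by norm_num) ?_ S
      linarith [Real.add_one_le_exp L]
    calc _ ≤ Real.exp (S * L) * Real.exp (-(5 * S * L)) :=
          mul_le_mul_of_nonneg_right h2 (Real.exp_pos _).le
      _ = Real.exp (-(4 * S * L)) := by rw [← Real.exp_add]; congr 1; ring
      _ ≤ Real.exp (-(4 * L)) := Real.exp_le_exp.mpr (by nlinarith)
      _ = q ^ 4 := hq4
  set P : ℝ := S * A * H * (d + 1) with hP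
  have hHP : (H : ℝ) ≤ P := by
    calc (H : ℝ) = 1 * 1 * H * 1 := by ring
      _ ≤ S * A * H * (d + 1) := by gcongr
  have hSAP : (S * A : ℝ) ≤ P := by
    calc (S * A : ℝ) = S * A * 1 * 1 := by ring
      _ ≤ S * A * H * (d + 1) := by gcongr
  have hP1 : 1 ≤ P := hH'.trans hHP
  have hqP : q * P * (k : ℝ) ^ 2 = δ / 8 := by
    rw [hq]; field_simp
  have hqPk : q * (P * k ^ 2) ≤ 1 / 8 := by rw [← mul_assoc, hqP]; linarith
  have hPk : P ≤ P * k ^ 2 := le_mul_of_one_le_right (by linarith) (one_le_pow₀ hk')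
  have hkP : (k : ℝ) ≤ P * k ^ 2 := by nlinarith
  have hqH : q * H ≤ 1 / 8 := (mul_le_mul_of_nonneg_left (hHP.trans hPk) hq0.le).trans hqPk
  have hqk : q * k ≤ 1 / 8 := (mul_le_mul_of_nonneg_left hkP hq0.le).trans hqPk
  have hq8 : q ≤ 1 / 8 := by nlinarith
  -- Of the four factors `q`, one turns `P * k ^ 2` into `δ / 8`, and the others pay for `H`, for
  -- `k` and for the constant.
  have hmain : P * (2 * (k * H) * q ^ 4) ≤ δ / 8 / k ^ 2 := by
    rw [le_div_iff₀ (by positivity)]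
    calc P * (2 * (k * H) * q ^ 4) * k ^ 2 = 2 * (q * P * k ^ 2) * (q * H) * (q * k) * q := by ring
      _ ≤ 2 * (δ / 8) * (1 / 8) * (1 / 8) * (1 / 8) := by rw [hqP]; gcongr
      _ ≤ δ / 8 := by linarith
  have h1 : S * A * (d + 1) * H * (2 * (k * H) * q ^ 4) ≤ δ / 8 / k ^ 2 :=
    (le_of_eq (by rw [hP]; ring)).trans hmain
  have h2 : S * A * (2 ^ S * (2 * (k * H) * Real.exp (-(5 * S * L)))) ≤ δ / 8 / k ^ 2 := by
    calc _ = S * A * (2 * (k * H) * (2 ^ S * Real.exp (-(5 * S * L)))) := by ring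
      _ ≤ P * (2 * (k * H) * q ^ 4) := by gcongr
      _ ≤ _ := hmain
  have h3 : q ≤ δ / 8 / k ^ 2 := by
    rw [le_div_iff₀ (by positivity), ← hqP]
    have : q * 1 ≤ q * P := mul_le_mul_of_nonneg_left hP1 hq0.le
    rw [mul_one] at this
    exact mul_le_mul_of_nonneg_right this (by positivity)
  rw [hq4]
  have h4 : δ * (1 / (k : ℝ) ^ 2) = 8 * (δ / 8 / k ^ 2) := by ring
  have h5 : 0 ≤ δ / 8 / (k : ℝ) ^ 2 := by positivity
  linarith

end LogTerm

/-! ### Arithmetic of the final bound. -/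

section FinalBound

theorem rpow_five_halves {x : ℝ} (hx : 0 ≤ x) : x ^ (5 / 2 : ℝ) = x ^ 2 * √x := by
  rw [show (5 / 2 : ℝ) = 2 + 1 / 2 by norm_num, Real.rpow_add' hx (by norm_num),
    ← Real.sqrt_eq_rpow]
  norm_num

theorem rpow_three_halves {x : ℝ} (hx : 0 ≤ x) : x ^ (3 / 2 : ℝ) = x * √x := by
  rw [show (3 / 2 : ℝ) = 1 + 1 / 2 by norm_num, Real.rpow_add' hx (by norm_num),
    ← Real.sqrt_eq_rpow, Real.rpow_one]

theorem regretBound_nonneg {c : ℝ} (hc : 0 ≤ c) (S A d H : ℕ) (δ : ℝ) (k : ℕ) :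
    0 ≤ regretBound c S A d H δ k := by
  unfold regretBound; positivity

/-- With `y` the argument of the logarithm on the right, the argument on the left is `8 * y * k`.
Since `k ≤ y` and `6 ≤ y`, it is at most `8 * y ^ 2 ≤ y ^ 4`. -/
theorem logTerm_le_four_mul {S A d H k : ℕ} {δ : ℝ} (hS : 1 ≤ S) (hA : 1 ≤ A) (hH : 1 ≤ H)
    (hk : 2 ≤ k) (hδ : 0 < δ) (hδ1 : δ ≤ 1 / 3) :
    logTerm S A d H δ k ≤ 4 * Real.log (S * A * H * (d + 1) * k / δ) := by
  have hk' : (2 : ℝ) ≤ k := by exact_mod_cast hk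
  have hP : (1 : ℝ) ≤ S * A * H * (d + 1) := one_le_natCast_mul hS hA hH
  rw [logTerm, show 8 * S * A * H * (d + 1) * (k : ℝ) ^ 2 / δ =
    8 * (S * A * H * (d + 1) * k / δ) * k by ring]
  generalize (S * A * H * (d + 1) : ℝ) = P at *
  have hy : 6 ≤ P * k / δ := by rw [le_div_iff₀ hδ]; nlinarith
  have hky : (k : ℝ) ≤ P * k / δ := by rw [le_div_iff₀ hδ]; nlinarith
  generalize P * k / δ = y at *
  have e : 4 * Real.log y = Real.log (y ^ 4) := by rw [Real.log_pow]; norm_num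
  rw [e]
  refine Real.log_le_log (by positivity) ?_
  have h8 : 8 ≤ y ^ 2 := by nlinarith
  calc 8 * y * k ≤ 8 * y * y := by gcongr
    _ = 8 * y ^ 2 := by ring
    _ ≤ y ^ 2 * y ^ 2 := mul_le_mul_of_nonneg_right h8 (sq_nonneg y)
    _ = y ^ 4 := by ring

set_option maxHeartbeats 400000 in
/-- The cumulative regret, bounded trivially and by the estimates, is within the regret bound. -/
theorem div_le_regretBound {S A d H k : ℕ} {δ x : ℝ} (hS : 1 ≤ S) (hA : 1 ≤ A) (hH : 1 ≤ H)
    (hk : 1 ≤ k) (hδ : 0 < δ) (hδ1 : δ ≤ 1 / 3) (hx : x ≤ k * H)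
    (hx' : x ≤ 10 * H ^ 2 * (2 * (√(10 * S * logTerm S A d H δ k) *
      (2 * H * (S * A) + 3 * √(S * A * (k * H)))) + 2 * H * logTerm S A d H δ k)) :
    1 / (k : ℝ) * x ≤ regretBound 1000 S A d H δ k := by
  have hk' : (1 : ℝ) ≤ k := by exact_mod_cast hk
  have hS' : (1 : ℝ) ≤ S := by exact_mod_cast hS
  have hA' : (1 : ℝ) ≤ A := by exact_mod_cast hA
  have hH' : (1 : ℝ) ≤ H := by exact_mod_cast hH
  have hP : (1 : ℝ) ≤ S * A * H * (d + 1) := one_le_natCast_mul hS hA hH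
  set P : ℝ := S * A * H * (d + 1) with hPdef
  have hk0 : (0 : ℝ) < k := by linarith
  set Λ := Real.log (P * k / δ) with hΛ
  set Λ' := Real.log (2 * P * k / δ) with hΛ'
  have hk3 : 3 ≤ P * k / δ := by
    rw [le_div_iff₀ hδ]; nlinarith
  have hΛ1 : 1 ≤ Λ := by
    rw [hΛ, Real.le_log_iff_exp_le (by linarith)]
    linarith [Real.exp_one_lt_d9]
  have hΛΛ' : Λ ≤ Λ' := by
    refine Real.log_le_log (by linarith) ?_
    gcongr
    linarith
  have hbd : (k : ℝ) * regretBound 1000 S A d H δ k =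
      1000 * √k * (H ^ 2 * √H) * S * √A * √(Real.log k * Λ) +
        1000 * (S * √S) * A * H ^ 3 * √Λ' := by
    have hsk := Real.sq_sqrt hk0.le
    have hsk0 : 0 < √(k : ℝ) := Real.sqrt_pos.mpr hk0
    rw [regretBound, rpow_five_halves (by linarith), rpow_three_halves (by linarith), ← hPdef,
      show (2 : ℝ) * S * A * H * (d + 1) = 2 * P by rw [hPdef]; ring, ← hΛ, ← hΛ']
    have e : (k : ℝ) * (1000 / √k) = 1000 * √k := by
      field_simp
      rw [hsk]
    have e2 : (k : ℝ) * (1000 / k) = 1000 := by field_simp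
    rw [mul_add]
    simp only [← mul_assoc]
    rw [e, e2]
  rw [one_div, inv_mul_le_iff₀ hk0, hbd]
  have hsS := Real.one_le_sqrt.mpr hS'
  have hsA := Real.one_le_sqrt.mpr hA'
  have hsH := Real.one_le_sqrt.mpr hH'
  have hsk := Real.one_le_sqrt.mpr hk'
  have hsΛ := Real.one_le_sqrt.mpr hΛ1
  have hsΛ' : √Λ ≤ √Λ' := Real.sqrt_le_sqrt hΛΛ'
  -- For `k = 1` the factor `log k` kills the main term, so the trivial bound `H` has to fit into
  -- the second one.
  rcases hk.eq_or_lt with rfl | hk2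
  · have h1 : (H : ℝ) ≤ 1000 * (S * √S) * A * H ^ 3 * √Λ' := by
      calc (H : ℝ) = 1 * (1 * 1) * 1 * H * 1 := by ring
        _ ≤ 1000 * (S * √S) * A * H ^ 3 * √Λ' := by
          gcongr
          · norm_num
          · nlinarith [sq_nonneg ((H : ℝ) - 1), mul_self_nonneg (H : ℝ)]
          · exact hsΛ.trans hsΛ'
    have h2 : (0 : ℝ) ≤ 1000 * √((1 : ℕ) : ℝ) * (H ^ 2 * √H) * S * √A *
      √(Real.log ((1 : ℕ) : ℝ) * Λ) := by positivity
    push_cast at hx h2 ⊢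
    linarith
  · have hk2' : (2 : ℝ) ≤ k := by exact_mod_cast hk2
    have hlogk : 1 / 2 ≤ Real.log k := by
      have := Real.log_le_log two_pos hk2'
      linarith [Real.log_two_gt_d9]
    -- From `log k ≥ 1/2 ≥ (7/10) ^ 2`.
    have hsl : 7 / 10 * √Λ ≤ √(Real.log k * Λ) := by
      rw [Real.sqrt_mul (by linarith)]
      refine mul_le_mul_of_nonneg_right ?_ (Real.sqrt_nonneg _)
      refine Real.le_sqrt_of_sq_le ?_
      linarith
    have hL : logTerm S A d H δ k ≤ 4 * Λ := logTerm_le_four_mul hS hA hH hk2 hδ hδ1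
    have hL0 : 0 ≤ logTerm S A d H δ k :=
      zero_le_one.trans (one_le_logTerm hS hA hH hk hδ (by linarith))
    set L := logTerm S A d H δ k
    have hsL : √(10 * S * L) ≤ 7 * √S * √Λ := by
      calc √(10 * S * L) ≤ √(49 * S * Λ) := Real.sqrt_le_sqrt (by nlinarith)
        _ = 7 * √S * √Λ := by
          rw [Real.sqrt_mul (by positivity), Real.sqrt_mul (by positivity),
            show (49 : ℝ) = 7 ^ 2 by norm_num, Real.sqrt_sq (by norm_num)]
    have hsSAkH : √(S * A * (k * H)) = √S * √A * √k * √H := by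
      rw [Real.sqrt_mul (by positivity), Real.sqrt_mul (by positivity),
        Real.sqrt_mul (by positivity)]
      ring
    have hsS2 := Real.mul_self_sqrt (show (0 : ℝ) ≤ S by linarith)
    have hsH2 := Real.mul_self_sqrt (show (0 : ℝ) ≤ H by linarith)
    have hsk2 := Real.mul_self_sqrt hk0.le
    have hsΛ2 := Real.mul_self_sqrt (show 0 ≤ Λ by linarith)
    set main : ℝ := √k * (H ^ 2 * √H) * S * √A * √Λ with hmain
    set low : ℝ := (S * √S) * A * H ^ 3 * √Λ with hlow
    have hgoal : 700 * main + 1000 * low ≤ 1000 * √k * (H ^ 2 * √H) * S * √A *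
        √(Real.log k * Λ) + 1000 * (S * √S) * A * H ^ 3 * √Λ' := by
      have h1 : 700 * main ≤ 1000 * √k * (H ^ 2 * √H) * S * √A * √(Real.log k * Λ) := by
        calc 700 * main = 1000 * √k * (H ^ 2 * √H) * S * √A * (7 / 10 * √Λ) := by
              rw [hmain]; ring
          _ ≤ _ := by gcongr
      have h2 : 1000 * low ≤ 1000 * (S * √S) * A * H ^ 3 * √Λ' := by
        calc 1000 * low = 1000 * (S * √S) * A * H ^ 3 * √Λ := by rw [hlow]; ring
          _ ≤ _ := by gcongr
      linarith
    refine le_trans ?_ hgoal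
    have hmain0 : 0 ≤ main := by positivity
    have hlow0 : 0 ≤ low := by positivity
    -- The stray term `H ^ 3 * Λ` is below `main` when `H * Λ ≤ k`; otherwise `√k ≤ √H * √Λ`, and
    -- the trivial bound `k * H` is itself below `main`.
    by_cases hcase : H * Λ ≤ k
    · have hlast : H ^ 3 * Λ ≤ main := by
        have h1 : √H * √Λ ≤ √k := by
          rw [← Real.sqrt_mul (by linarith)]; exact Real.sqrt_le_sqrt hcase
        calc (H : ℝ) ^ 3 * Λ = (√H * √Λ) * (H ^ 2 * √H) * 1 * 1 * √Λ := by
              rw [show (√H * √Λ) * ((H : ℝ) ^ 2 * √H) * 1 * 1 * √Λ =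
                H ^ 2 * (√H * √H) * (√Λ * √Λ) by ring, hsH2, hsΛ2]; ring
          _ ≤ main := by rw [hmain]; gcongr
      calc x ≤ _ := hx'
        _ ≤ 10 * H ^ 2 * (2 * ((7 * √S * √Λ) *
          (2 * H * (S * A) + 3 * (√S * √A * √k * √H))) + 2 * H * (4 * Λ)) := by
            rw [hsSAkH]; gcongr
        _ = 280 * low + 420 * main + 80 * (H ^ 3 * Λ) := by
            rw [hlow, hmain]
            have : (√S * √S * (√A * √k * √H * √Λ) * H ^ 2 : ℝ) =
              S * (√A * √k * √H * √Λ) * H ^ 2 := by rw [hsS2]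
            linear_combination 420 * this
        _ ≤ _ := by linarith
    · push Not at hcase
      have h1 : √k ≤ √H * √Λ := by
        rw [← Real.sqrt_mul (by linarith)]; exact Real.sqrt_le_sqrt hcase.le
      have h2 : (k : ℝ) * H ≤ main := by
        calc (k : ℝ) * H = √k * (H * √k) * 1 * 1 := by
              rw [show √k * (H * √k) * 1 * 1 = √k * √k * (H : ℝ) by ring, hsk2]
          _ ≤ √k * (H ^ 2 * (√H * √Λ)) * S * √A := by
              gcongr
              nlinarith
          _ = main := by rw [hmain]; ring
      linarith

end FinalBound

/-! ### The event of accurate estimates and the regret on it. -/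

section GoodEvent

set_option linter.unusedSectionVars false

variable {S A ι Ω : Type*} [Fintype S] [DecidableEq S] [Fintype A] [DecidableEq A] [Fintype ι]
  [mΩ : MeasurableSpace Ω] {μ : Measure Ω} {ℱ : Filtration ℕ mΩ}
  {H : ℕ} {s₀ : S} {ξ : ι → ℝ} {δ : ℝ} {M : CMDP S A ι} {πstar : Policy S A}
  {π : ℕ → Ω → Policy S A} {O : Observations S A ι Ω} {k : ℕ} {ω : Ω}

/-- The logarithm in the bonus of episode `k`, for the given sets of states, actions, resources. -/
noncomputable abbrev logBonus (S A ι : Type*) [Fintype S] [Fintype A] [Fintype ι] (H : ℕ) (δ : ℝ)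
    (k : ℕ) : ℝ :=
  logTerm (Fintype.card S) (Fintype.card A) (Fintype.card ι) H δ k

/-- The scale of the uncertainty about `(s, a)` before episode `k`. -/
noncomputable def uncertainty (H : ℕ) (δ : ℝ) (O : Observations S A ι Ω) (k : ℕ) (ω : Ω) (s : S)
    (a : A) : ℝ :=
  min 1 √(10 * Fintype.card S * logBonus S A ι H δ k / visitCount H O k ω s a)

theorem uncertainty_mem_Icc (H : ℕ) (δ : ℝ) (O : Observations S A ι Ω) (k : ℕ) (ω : Ω) (s : S)
    (a : A) : uncertainty H δ O k ω s a ∈ Set.Icc (0 : ℝ) 1 :=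
  ⟨le_min zero_le_one (Real.sqrt_nonneg _), min_le_left _ _⟩

/-- The estimates of episode `k` are accurate. -/
structure AccurateEstimates (H : ℕ) (s₀ : S) (δ : ℝ) (M : CMDP S A ι) (πstar : Policy S A)
    (π : ℕ → Ω → Policy S A) (O : Observations S A ι Ω) (k : ℕ) (ω : Ω) : Prop where
  bellman : ∀ s a o, ∀ h < H, 1 ≤ rawCount H O k ω s a →
    |empMean H O (O.outcome o) k ω s a - M.mean o s a +
        ∑ s', (empTransition H O k ω s a s' - M.p s a s') *
          valueFn H πstar M.p (M.mean o) (h + 1) s'| <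
      H * √(4 * logBonus S A ι H δ k / (2 * rawCount H O k ω s a))
  transition : ∀ s a, 1 ≤ rawCount H O k ω s a →
    ∑ s', |empTransition H O k ω s a s' - M.p s a s'| <
      2 * √(5 * Fintype.card S * logBonus S A ι H δ k / (2 * rawCount H O k ω s a))
  total : ∑ t ∈ Finset.Ico 1 (k + 1), expTotal H s₀ (π t ω) M.p (uncertainty H δ O t ω) <
    2 * ∑ t ∈ Finset.Ico 1 (k + 1), ∑ h ∈ Finset.range H,
        uncertainty H δ O t ω (O.state t h ω) (O.action t h ω) + 2 * H * logBonus S A ι H δ k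

/-- A union bound: the Bellman errors of all pairs, outcomes and steps at level `4 L`, the
transition rows at level `5 S L`, and the comparison of totals at level `L`. The levels exceed `L`
where the union over counts and sign patterns has to be paid for. -/
theorem measure_not_accurateEstimates_le [IsProbabilityMeasure μ] [Nonempty S] [Nonempty A]
    (hM : M.IsProper) (hFP : FollowsProtocol μ ℱ H s₀ M π O) (hπstar : IsPolicy H πstar)
    (hH : 1 ≤ H) (hδ : 0 < δ) (hδ1 : δ ≤ 1) (hk : 1 ≤ k) :
    μ {ω | ¬ AccurateEstimates H s₀ δ M πstar π O k ω} ≤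
      ENNReal.ofReal (δ * (1 / (k : ℝ) ^ 2)) := by
  have hS : 1 ≤ Fintype.card S := Fintype.card_pos
  have hA : 1 ≤ Fintype.card A := Fintype.card_pos
  have hL : 1 ≤ logBonus S A ι H δ k := one_le_logTerm hS hA hH hk hδ hδ1
  have hsub : {ω | ¬ AccurateEstimates H s₀ δ M πstar π O k ω} ⊆
      (⋃ i : S × A × Option ι × Fin H, {ω | 1 ≤ rawCount H O k ω i.1 i.2.1 ∧
        H * √(4 * logBonus S A ι H δ k / (2 * rawCount H O k ω i.1 i.2.1)) ≤
        |empMean H O (O.outcome i.2.2.1) k ω i.1 i.2.1 - M.mean i.2.2.1 i.1 i.2.1 +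
          ∑ s', (empTransition H O k ω i.1 i.2.1 s' - M.p i.1 i.2.1 s') *
            valueFn H πstar M.p (M.mean i.2.2.1) (i.2.2.2 + 1) s'|}) ∪
      (⋃ i : S × A, {ω | 1 ≤ rawCount H O k ω i.1 i.2 ∧
        2 * √(5 * Fintype.card S * logBonus S A ι H δ k / (2 * rawCount H O k ω i.1 i.2)) ≤
        ∑ s', |empTransition H O k ω i.1 i.2 s' - M.p i.1 i.2 s'|}) ∪
      {ω | 2 * ∑ t ∈ Finset.Ico 1 (k + 1), ∑ h ∈ Finset.range H,
          uncertainty H δ O t ω (O.state t h ω) (O.action t h ω) +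
            2 * H * logBonus S A ι H δ k ≤
        ∑ t ∈ Finset.Ico 1 (k + 1), expTotal H s₀ (π t ω) M.p (uncertainty H δ O t ω)} := by
    intro ω hω
    by_contra hcon
    rw [Set.mem_union, Set.mem_union, not_or, not_or, Set.mem_iUnion, Set.mem_iUnion] at hcon
    obtain ⟨⟨h1, h2⟩, h3⟩ := hcon
    refine hω ⟨fun s a o h hh hr => ?_, fun s a hr => ?_, not_le.mp h3⟩
    · exact not_le.mp fun hle => h1 ⟨(s, a, o, ⟨h, hh⟩), hr, hle⟩
    · exact not_le.mp fun hle => h2 ⟨(s, a), hr, hle⟩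
  have hm : ∀ t, 1 ≤ t → ∀ s a, Measurable[ℱ (preTime H t 0)] fun ω =>
      uncertainty H δ O t ω s a := fun t _ s a => by
    have h1 : Measurable[ℱ (preTime H t 0)] fun ω => visitCount H O t ω s a :=
      measurable_const.max (measurable_rawCount hFP t s a)
    exact measurable_const.min (Real.continuous_sqrt.measurable.comp (measurable_const.div h1))
  have b1 := fun i : S × A × Option ι × Fin H => measure_abs_bellman_error_ge_le hM hFP hπstar
    i.1 i.2.1 i.2.2.1 i.2.2.2.2 k (x := 4 * logBonus S A ι H δ k) (by linarith)
  have b2 := fun i : S × A => measure_sum_abs_empTransition_sub_ge_le hM hFP i.1 i.2 k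
    (x := 5 * Fintype.card S * logBonus S A ι H δ k) (by positivity)
  have b3 := measure_sum_expTotal_ge_le hM hFP hH (uncertainty H δ O) hm
    (uncertainty_mem_Icc H δ O) (k + 1) (logBonus S A ι H δ k)
  refine (measure_mono hsub).trans ((measure_union_le _ _).trans
    ((add_le_add ((measure_union_le _ _).trans (add_le_add
      ((measure_iUnion_fintype_le _ _).trans (Finset.sum_le_sum fun i _ => b1 i))
      ((measure_iUnion_fintype_le _ _).trans (Finset.sum_le_sum fun i _ => b2 i)))) b3).trans ?_))
  refine le_trans (le_of_eq ?_) (ENNReal.ofReal_le_ofReal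
    (failure_prob_le (d := Fintype.card ι) hS hA hH hk hδ hδ1))
  rw [Finset.sum_const, Finset.sum_const, Finset.card_univ, Finset.card_univ, nsmul_eq_mul,
    nsmul_eq_mul, ← ENNReal.ofReal_natCast, ← ENNReal.ofReal_natCast,
    ← ENNReal.ofReal_mul (by positivity),
    show (2 : ENNReal) ^ Fintype.card S = ENNReal.ofReal (2 ^ Fintype.card S) by
      rw [ENNReal.ofReal_pow (by norm_num)]; norm_num,
    ← ENNReal.ofReal_mul (by positivity), ← ENNReal.ofReal_mul (by positivity),
    ← ENNReal.ofReal_add (by positivity) (by positivity),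
    ← ENNReal.ofReal_add (by positivity) (by positivity)]
  congr 1
  simp only [Fintype.card_prod, Fintype.card_option, Fintype.card_fin]
  push_cast
  ring

/-- The estimates of all episodes are accurate with high probability. -/
theorem measure_exists_not_accurateEstimates_le [IsProbabilityMeasure μ] [Nonempty S] [Nonempty A]
    (hM : M.IsProper) (hFP : FollowsProtocol μ ℱ H s₀ M π O) (hπstar : IsPolicy H πstar)
    (hH : 1 ≤ H) (hδ : 0 < δ) (hδ1 : δ ≤ 1) :
    μ {ω | ∃ k, 1 ≤ k ∧ ¬ AccurateEstimates H s₀ δ M πstar π O k ω} ≤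
      ENNReal.ofReal (3 * δ) := by
  -- The series starts at `k = 0`, where `1 / 0 ^ 2 = 0` and the event is empty. Its sum `π ^ 2 / 6`
  -- is below `3`.
  have hsum : HasSum (fun k : ℕ => δ * (1 / (k : ℝ) ^ 2)) (δ * (Real.pi ^ 2 / 6)) :=
    hasSum_zeta_two.mul_left δ
  calc _ ≤ μ (⋃ k : ℕ, {ω | 1 ≤ k ∧ ¬ AccurateEstimates H s₀ δ M πstar π O k ω}) := by
        refine measure_mono fun ω hω => ?_
        obtain ⟨k, hk⟩ := hω
        exact Set.mem_iUnion.mpr ⟨k, hk⟩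
    _ ≤ ∑' k : ℕ, μ {ω | 1 ≤ k ∧ ¬ AccurateEstimates H s₀ δ M πstar π O k ω} :=
        measure_iUnion_le _
    _ ≤ ∑' k : ℕ, ENNReal.ofReal (δ * (1 / (k : ℝ) ^ 2)) := by
        refine ENNReal.tsum_le_tsum fun k => ?_
        by_cases hk : 1 ≤ k
        · simpa only [hk, true_and] using
            measure_not_accurateEstimates_le hM hFP hπstar hH hδ hδ1 hk
        · simp [hk]
    _ = ENNReal.ofReal (δ * (Real.pi ^ 2 / 6)) := by
        rw [← ENNReal.ofReal_tsum_of_nonneg (fun k => by positivity) hsum.summable, hsum.tsum_eq]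
    _ ≤ _ := by
        refine ENNReal.ofReal_le_ofReal ?_
        nlinarith [Real.pi_lt_d2, Real.pi_pos, mul_pos hδ Real.pi_pos]

/-- All rewards and consumptions lie in `[0, 1]`. -/
def BoundedOutcomes (H : ℕ) (O : Observations S A ι Ω) (ω : Ω) : Prop :=
  ∀ o, ∀ t, 1 ≤ t → ∀ h < H, O.outcome o t h ω ∈ Set.Icc (0 : ℝ) 1

theorem ae_boundedOutcomes (hFP : FollowsProtocol μ ℱ H s₀ M π O) :
    ∀ᵐ ω ∂μ, BoundedOutcomes H O ω := by
  refine ae_all_iff.mpr fun o => ae_all_iff.mpr fun t => ae_all_iff.mpr fun ht =>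
    ae_all_iff.mpr fun h => ae_all_iff.mpr fun hh => hFP.outcome_mem o ht hh

theorem bonus_nonneg (H : ℕ) (δ : ℝ) (O : Observations S A ι Ω) (k : ℕ) (ω : Ω) (s : S) (a : A) :
    0 ≤ bonus H δ O k ω s a := by
  unfold bonus; positivity

theorem bonus_eq (H : ℕ) (δ : ℝ) (O : Observations S A ι Ω) (k : ℕ) (ω : Ω) (s : S) (a : A) :
    bonus H δ O k ω s a =
      min (2 * (H : ℝ)) (H * √(2 * logBonus S A ι H δ k / visitCount H O k ω s a)) := rfl

/-- Clipping the bonus at `2 H` corresponds to clipping the uncertainty at `1`. -/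
theorem bonus_le_uncertainty (hS : 1 ≤ Fintype.card S) (hL : 1 ≤ logBonus S A ι H δ k) (s : S)
    (a : A) : bonus H δ O k ω s a ≤ 2 * H * uncertainty H δ O k ω s a := by
  have hN := one_le_visitCount H O k ω s a
  have hS' : (1 : ℝ) ≤ Fintype.card S := by exact_mod_cast hS
  rw [bonus_eq, uncertainty, mul_min_of_nonneg _ _ (by positivity), mul_one]
  refine min_le_min_left _ ?_
  calc (H : ℝ) * √(2 * logBonus S A ι H δ k / visitCount H O k ω s a)
      ≤ H * √(10 * Fintype.card S * logBonus S A ι H δ k / visitCount H O k ω s a) := by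
        gcongr
        nlinarith
    _ ≤ _ := by
        have := Real.sqrt_nonneg
          (10 * Fintype.card S * logBonus S A ι H δ k / visitCount H O k ω s a)
        have := mul_nonneg (Nat.cast_nonneg (α := ℝ) H) this
        linarith

/-- Two rows of mass at most one differ by at most `2`. This covers the clipped case and unvisited
pairs, for which `10 S L ≥ 1`; visited pairs use the good event. -/
theorem sum_abs_empTransition_sub_le (hM : M.IsProper)
    (hS : 1 ≤ Fintype.card S) (hL : 1 ≤ logBonus S A ι H δ k)
    (hgood : AccurateEstimates H s₀ δ M πstar π O k ω) (s : S) (a : A) :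
    ∑ s', |empTransition H O k ω s a s' - M.p s a s'| ≤ 2 * uncertainty H δ O k ω s a := by
  have hS' : (1 : ℝ) ≤ Fintype.card S := by exact_mod_cast hS
  have htriv : ∑ s', |empTransition H O k ω s a s' - M.p s a s'| ≤ 2 := by
    calc _ ≤ ∑ s', (empTransition H O k ω s a s' + M.p s a s') :=
          Finset.sum_le_sum fun s' _ => by
            have h1 := empTransition_nonneg H O k ω s a s'
            have h2 := (hM.p_mem s a).1 s'
            rw [abs_le]; constructor <;> linarith
      _ ≤ 1 + 1 := by
          rw [Finset.sum_add_distrib, (hM.p_mem s a).2]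
          linarith [sum_empTransition_le_one H O k ω s a]
      _ = 2 := by norm_num
  rw [uncertainty, mul_min_of_nonneg _ _ (by norm_num), mul_one]
  refine le_min htriv ?_
  rcases rawCount_eq_zero_or_visitCount_eq H O k ω s a with h0 | ⟨h1, hN⟩
  · rw [visitCount_eq_max, h0, max_eq_left zero_le_one, div_one]
    have : 1 ≤ √(10 * Fintype.card S * logBonus S A ι H δ k) :=
      Real.one_le_sqrt.mpr (by nlinarith)
    linarith
  · refine (hgood.transition s a h1).le.trans ?_
    rw [hN]
    have hC : 0 < rawCount H O k ω s a := by linarith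
    gcongr 2 * √?_
    rw [div_le_div_iff₀ (by positivity) hC]
    have : 0 ≤ Fintype.card S * logBonus S A ι H δ k * rawCount H O k ω s a := by positivity
    linarith

/-- At a visited pair `4 L / (2 N) = 2 L / N` is exactly the quantity in the bonus. At an unvisited
pair the bonus is at least `H`, which bounds the error trivially; the same trivial bound handles the
clipping at `2 H`. -/
theorem abs_bellman_error_le_bonus (hM : M.IsProper) (hπstar : IsPolicy H πstar)
    (hL : 1 ≤ logBonus S A ι H δ k)
    (hgood : AccurateEstimates H s₀ δ M πstar π O k ω) (hω : BoundedOutcomes H O ω) (s : S) (a : A)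
    (o : Option ι) {h : ℕ} (hh : h < H) :
    |empMean H O (O.outcome o) k ω s a - M.mean o s a +
        ∑ s', (empTransition H O k ω s a s' - M.p s a s') *
          valueFn H πstar M.p (M.mean o) (h + 1) s'| ≤ bonus H δ O k ω s a := by
  have hH : 1 ≤ H := by omega
  have hH' : (1 : ℝ) ≤ H := by exact_mod_cast hH
  have hV : ∀ s', valueFn H πstar M.p (M.mean o) (h + 1) s' ∈ Set.Icc (0 : ℝ) ((H : ℝ) - 1) := by
    intro s'
    have h' := valueFn_mem_Icc hπstar hM.p_mem (hM.mean_mem o) (Nat.succ_le_of_lt hh) s'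
    refine ⟨h'.1, h'.2.trans ?_⟩
    have : H - (h + 1) + 1 ≤ H := by omega
    have : ((H - (h + 1) : ℕ) : ℝ) + 1 ≤ H := by exact_mod_cast this
    linarith
  have htriv : |empMean H O (O.outcome o) k ω s a - M.mean o s a +
      ∑ s', (empTransition H O k ω s a s' - M.p s a s') *
        valueFn H πstar M.p (M.mean o) (h + 1) s'| ≤ H := by
    have h1 := empMean_mem_Icc (O := O) (hω o) k s a
    have h2 := hM.mean_mem o s a
    have h3 := sum_mul_mem_Icc_of_mem_stdSimplex (hM.p_mem s a) hV
    have h4 := abs_sum_mul_le_of_sum_le_one (empTransition_nonneg H O k ω s a)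
      (sum_empTransition_le_one H O k ω s a) (by linarith : (0 : ℝ) ≤ H - 1)
      (fun s' => abs_le.mpr ⟨by linarith [(hV s').1], (hV s').2⟩)
    have h5 : 0 ≤ ∑ s', empTransition H O k ω s a s' *
        valueFn H πstar M.p (M.mean o) (h + 1) s' :=
      Finset.sum_nonneg fun s' _ => mul_nonneg (empTransition_nonneg H O k ω s a s') (hV s').1
    simp only [sub_mul, Finset.sum_sub_distrib]
    rw [abs_le] at h4 ⊢
    constructor <;> linarith [h1.1, h1.2, h2.1, h2.2, h3.1, h3.2, h4.2]
  rw [bonus_eq]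
  refine le_min (htriv.trans (by linarith)) ?_
  rcases rawCount_eq_zero_or_visitCount_eq H O k ω s a with h0 | ⟨h1, hN⟩
  · rw [visitCount_eq_max, h0, max_eq_left zero_le_one, div_one]
    have : 1 ≤ √(2 * logBonus S A ι H δ k) := Real.one_le_sqrt.mpr (by linarith)
    exact htriv.trans (le_mul_of_one_le_right (by linarith) this)
  · refine (hgood.bellman s a o h hh h1).le.trans (le_of_eq ?_)
    rw [hN]
    congr 2
    have hC : 0 < rawCount H O k ω s a := by linarith
    field_simp
    ring

/-- The Bellman error of the last step has no continuation value. -/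
theorem abs_empMean_sub_le_bonus (hM : M.IsProper) (hπstar : IsPolicy H πstar) (hH : 1 ≤ H)
    (hL : 1 ≤ logBonus S A ι H δ k)
    (hgood : AccurateEstimates H s₀ δ M πstar π O k ω) (hω : BoundedOutcomes H O ω) (s : S) (a : A)
    (o : Option ι) :
    |empMean H O (O.outcome o) k ω s a - M.mean o s a| ≤ bonus H δ O k ω s a := by
  have := abs_bellman_error_le_bonus hM hπstar hL hgood hω s a o (h := H - 1) (by omega)
  rw [Nat.sub_add_cancel hH] at this
  simpa [valueFn_horizon] using this

/-- The learner's policy is at least as good as `πstar` in the bonus-enhanced model, and feasible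
there. -/
theorem chosen_policy_optimistic (hM : M.IsProper) (hstar : IsOptimal H s₀ ξ M πstar) (hk : 1 ≤ k)
    (hL : 1 ≤ logBonus S A ι H δ k) (hchosen : ChosenByConRL H s₀ ξ δ O π)
    (hgood : AccurateEstimates H s₀ δ M πstar π O k ω) (hω : BoundedOutcomes H O ω) :
    IsFeasible H s₀ ξ (bonusModel H δ O k ω) (π k ω) ∧
      expTotal H s₀ πstar M.p M.r ≤
        expTotal H s₀ (π k ω) (bonusModel H δ O k ω).p (bonusModel H δ O k ω).r := by
  have hp := hstar.1.1
  -- The comparison runs along the empirical transitions but with the true values of `πstar`, which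
  -- are the fixed functions covered by the good event.
  have hfeas : IsFeasible H s₀ ξ (bonusModel H δ O k ω) πstar := by
    refine ⟨hp, fun i => (expTotal_le_expTotal_of_step' hp (empTransition_nonneg H O k ω)
      fun h hh s a => ?_).trans (hstar.1.2 i)⟩
    have := (abs_le.mp (abs_bellman_error_le_bonus hM hp hL hgood hω s a (some i) hh)).2
    change empMean H O (O.outcome (some i)) k ω s a - bonus H δ O k ω s a - M.mean (some i) s a +
      ∑ s', (empTransition H O k ω s a s' - M.p s a s') *
        valueFn H πstar M.p (M.mean (some i)) (h + 1) s' ≤ 0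
    linarith
  have hopt := hchosen k hk ω ⟨πstar, hfeas⟩
  refine ⟨hopt.1, le_trans ?_ (hopt.2 πstar hfeas)⟩
  refine expTotal_le_expTotal_of_step hp (empTransition_nonneg H O k ω) fun h hh s a => ?_
  have := (abs_le.mp (abs_bellman_error_le_bonus hM hp hL hgood hω s a none hh)).1
  change 0 ≤ empMean H O (O.outcome none) k ω s a + bonus H δ O k ω s a - M.mean none s a +
    ∑ s', (empTransition H O k ω s a s' - M.p s a s') *
      valueFn H πstar M.p (M.mean none) (h + 1) s'
  linarith

/-- The totals of the learner's policy in the true and in the bonus-enhanced model are close. -/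
theorem abs_expTotal_sub_bonusModel_le (hM : M.IsProper) (hπstar : IsPolicy H πstar) (hH : 1 ≤ H)
    (hS : 1 ≤ Fintype.card S) (hL : 1 ≤ logBonus S A ι H δ k) {π' : Policy S A}
    (hπ' : IsPolicy H π') (hgood : AccurateEstimates H s₀ δ M πstar π O k ω)
    (hω : BoundedOutcomes H O ω) (o : Option ι) :
    |expTotal H s₀ π' M.p (M.mean o) - expTotal H s₀ π' (bonusModel H δ O k ω).p
        ((bonusModel H δ O k ω).mean o)| ≤
      10 * H ^ 2 * expTotal H s₀ π' M.p (uncertainty H δ O k ω) := by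
  have hH' : (1 : ℝ) ≤ H := by exact_mod_cast hH
  have hb0 := bonus_nonneg H δ O k ω
  have hbH : ∀ s a, bonus H δ O k ω s a ≤ 2 * H := fun s a => min_le_left _ _
  have hest : ∀ s a, |(bonusModel H δ O k ω).mean o s a -
      empMean H O (O.outcome o) k ω s a| ≤ bonus H δ O k ω s a := by
    intro s a
    cases o with
    | none =>
      change |empMean H O (O.outcome none) k ω s a + bonus H δ O k ω s a -
        empMean H O (O.outcome none) k ω s a| ≤ _
      rw [add_sub_cancel_left, abs_of_nonneg (hb0 s a)]
    | some i =>
      change |empMean H O (O.outcome (some i)) k ω s a - bonus H δ O k ω s a -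
        empMean H O (O.outcome (some i)) k ω s a| ≤ _
      rw [sub_sub_cancel_left, abs_neg, abs_of_nonneg (hb0 s a)]
  rw [← expTotal_const_mul]
  -- Clipping bounds the model's outcomes by `1 + 2 H`, hence its values by `H (1 + 2 H) ≤ 3 H ^ 2`.
  -- The factor `10 H ^ 2` is `4 H ≤ 4 H ^ 2` from two bonuses plus `3 H ^ 2 * 2` from the
  -- transitions.
  refine abs_expTotal_sub_le (b := 1 + 2 * H) (B := 3 * H ^ 2) hπ' (fun s a => (hM.p_mem s a).1)
    (empTransition_nonneg H O k ω) (sum_empTransition_le_one H O k ω) (by positivity)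
    (fun s a => ?_) (by nlinarith) (fun s a => ?_)
  · have h1 := abs_le.mp (hest s a)
    have h2 := empMean_mem_Icc (O := O) (hω o) k s a
    rw [abs_le]
    constructor <;> linarith [h1.1, h1.2, h2.1, h2.2, hbH s a]
  · have h1 := abs_le.mp (hest s a)
    have h2 := abs_le.mp (abs_empMean_sub_le_bonus hM hπstar hH hL hgood hω s a o)
    have h3 := bonus_le_uncertainty (O := O) (ω := ω) hS hL s a
    have h4 := sum_abs_empTransition_sub_le hM hS hL hgood s a
    have h5 : |M.mean o s a - (bonusModel H δ O k ω).mean o s a| ≤ 2 * bonus H δ O k ω s a := by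
      rw [abs_le]
      constructor <;> linarith [h1.1, h1.2, h2.1, h2.2]
    have h6 : ∑ s', |M.p s a s' - (bonusModel H δ O k ω).p s a s'| ≤
        2 * uncertainty H δ O k ω s a := by
      simp only [abs_sub_comm (M.p s a _)]
      exact h4
    have hu := (uncertainty_mem_Icc H δ O k ω s a).1
    have h7 : (H : ℝ) * uncertainty H δ O k ω s a ≤ H ^ 2 * uncertainty H δ O k ω s a :=
      mul_le_mul_of_nonneg_right (by nlinarith) hu
    have h8 : 3 * (H : ℝ) ^ 2 * ∑ s', |M.p s a s' - (bonusModel H δ O k ω).p s a s'| ≤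
        3 * (H : ℝ) ^ 2 * (2 * uncertainty H δ O k ω s a) :=
      mul_le_mul_of_nonneg_left h6 (by positivity)
    linarith

/-- The realized uncertainty is small. -/
theorem sum_uncertainty_le [Nonempty S] [Nonempty A] (hH : 1 ≤ H) (hδ : 0 < δ)
    (O : Observations S A ι Ω) (k : ℕ) (ω : Ω) :
    ∑ t ∈ Finset.Ico 1 (k + 1), ∑ h ∈ Finset.range H,
        uncertainty H δ O t ω (O.state t h ω) (O.action t h ω) ≤
      √(10 * Fintype.card S * logBonus S A ι H δ k) *
        (2 * H * (Fintype.card S * Fintype.card A) +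
          3 * √(Fintype.card S * Fintype.card A * (k * H))) := by
  have hS : 1 ≤ Fintype.card S := Fintype.card_pos
  have hA : 1 ≤ Fintype.card A := Fintype.card_pos
  have hH' : (1 : ℝ) ≤ H := by exact_mod_cast hH
  set c := √(10 * Fintype.card S * logBonus S A ι H δ k) with hc
  let n : S → A → ℕ → ℝ := fun s a t => ∑ h ∈ Finset.range H,
    if O.state t h ω = s ∧ O.action t h ω = a then 1 else 0
  have hn0 : ∀ s a t, 0 ≤ n s a t := fun s a t =>
    Finset.sum_nonneg fun h _ => (one_ite_mem_Icc _).1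
  have hnH : ∀ s a t, n s a t ≤ H := fun s a t => by
    calc n s a t ≤ ∑ h ∈ Finset.range H, (1 : ℝ) :=
          Finset.sum_le_sum fun h _ => (one_ite_mem_Icc _).2
      _ = H := by simp
  -- Later logarithms dominate earlier ones, so the factor `c` of episode `k` serves all `t ≤ k`;
  -- the steps are then grouped by the pair visited.
  have hstep : ∀ t ∈ Finset.Ico 1 (k + 1), ∑ h ∈ Finset.range H,
      uncertainty H δ O t ω (O.state t h ω) (O.action t h ω) ≤
      c * ∑ s, ∑ a, n s a t / √(max 1 (∑ j ∈ Finset.Ico 1 t, n s a j)) := by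
    intro t ht
    have ht := Finset.mem_Ico.mp ht
    have hu : ∀ s a, uncertainty H δ O t ω s a ≤ c * (1 / √(visitCount H O t ω s a)) := by
      intro s a
      refine (min_le_right _ _).trans ?_
      rw [Real.sqrt_div' _ (zero_le_one.trans (one_le_visitCount H O t ω s a)), mul_one_div]
      refine div_le_div_of_nonneg_right (Real.sqrt_le_sqrt ?_) (Real.sqrt_nonneg _)
      exact mul_le_mul_of_nonneg_left (logTerm_mono hS hA hH hδ ht.1 (by omega)) (by positivity)
    calc _ ≤ ∑ h ∈ Finset.range H, c * (1 / √(visitCount H O t ω (O.state t h ω)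
          (O.action t h ω))) := Finset.sum_le_sum fun h _ => hu _ _
      _ = ∑ h ∈ Finset.range H, c * ∑ s, ∑ a,
          (if O.state t h ω = s ∧ O.action t h ω = a then 1 else 0) /
            √(visitCount H O t ω s a) := by
          refine Finset.sum_congr rfl fun h _ => ?_
          rw [Finset.sum_eq_single (O.state t h ω), Finset.sum_eq_single (O.action t h ω)] <;>
            simp +contextual [eq_comm]
      _ = _ := by
          rw [← Finset.mul_sum, Finset.sum_comm]
          congr 1
          refine Finset.sum_congr rfl fun s _ => ?_
          rw [Finset.sum_comm]
          refine Finset.sum_congr rfl fun a _ => ?_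
          rw [← Finset.sum_div]
          rfl
  have hraw : ∑ x : S × A, ∑ j ∈ Finset.Ico 1 (k + 1), n x.1 x.2 j = k * H := by
    rw [Finset.sum_comm]
    have : ∀ j ∈ Finset.Ico 1 (k + 1), ∑ x : S × A, n x.1 x.2 j = H := by
      intro j _
      rw [Finset.sum_comm]
      have : ∀ h ∈ Finset.range H, (∑ x : S × A,
          if O.state j h ω = x.1 ∧ O.action j h ω = x.2 then (1 : ℝ) else 0) = 1 := by
        intro h _
        rw [Finset.sum_eq_single (O.state j h ω, O.action j h ω)]
        · simp
        · rintro ⟨s, a⟩ _ hne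
          rw [if_neg]
          rintro ⟨h1, h2⟩
          exact hne (by rw [h1, h2])
        · simp
      rw [Finset.sum_congr rfl this]; simp
    rw [Finset.sum_congr rfl this]; simp
  -- Cauchy–Schwarz over the pairs, whose counts add up to `k * H`.
  have hsqrt : ∑ x : S × A, √(∑ j ∈ Finset.Ico 1 (k + 1), n x.1 x.2 j) ≤
      √(Fintype.card S * Fintype.card A * (k * H)) := by
    refine Real.le_sqrt_of_sq_le (sq_sum_le_card_mul_sum_sq.trans (le_of_eq ?_))
    rw [← hraw, Finset.card_univ, Fintype.card_prod]
    push_cast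
    congr 1
    exact Finset.sum_congr rfl fun x _ =>
      Real.sq_sqrt (Finset.sum_nonneg fun j _ => hn0 _ _ j)
  calc _ ≤ ∑ t ∈ Finset.Ico 1 (k + 1),
        c * ∑ s, ∑ a, n s a t / √(max 1 (∑ j ∈ Finset.Ico 1 t, n s a j)) :=
        Finset.sum_le_sum hstep
    _ = c * ∑ x : S × A, ∑ t ∈ Finset.Ico 1 (k + 1),
        n x.1 x.2 t / √(max 1 (∑ j ∈ Finset.Ico 1 t, n x.1 x.2 j)) := by
        rw [← Finset.mul_sum, Finset.sum_comm (s := Finset.univ)]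
        simp only [Fintype.sum_prod_type]
    _ ≤ c * ∑ x : S × A, (2 * H + 3 * √(∑ j ∈ Finset.Ico 1 (k + 1), n x.1 x.2 j)) := by
        refine mul_le_mul_of_nonneg_left (Finset.sum_le_sum fun x _ => ?_) (Real.sqrt_nonneg _)
        exact sum_div_sqrt_cumulative_le hH' _ (hn0 x.1 x.2) (hnH x.1 x.2) (k + 1)
    _ ≤ _ := by
        refine mul_le_mul_of_nonneg_left ?_ (Real.sqrt_nonneg _)
        rw [Finset.sum_add_distrib, Finset.sum_const, Finset.card_univ, Fintype.card_prod,
          nsmul_eq_mul, ← Finset.mul_sum]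
        push_cast
        linarith

/-- Cumulative regrets that are controlled by the uncertainty are within the regret bound. -/
theorem mean_le_regretBound [Nonempty S] [Nonempty A] (hH : 1 ≤ H) (hδ : 0 < δ) (hδ1 : δ ≤ 1 / 3)
    (hk : 1 ≤ k) (hgood : AccurateEstimates H s₀ δ M πstar π O k ω) (x : ℕ → ℝ)
    (hxH : ∀ t, 1 ≤ t → x t ≤ H)
    (hx : ∀ t, 1 ≤ t →
      x t ≤ 10 * H ^ 2 * expTotal H s₀ (π t ω) M.p (uncertainty H δ O t ω)) :
    1 / (k : ℝ) * ∑ t ∈ Finset.Icc 1 k, x t ≤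
      regretBound 1000 (Fintype.card S) (Fintype.card A) (Fintype.card ι) H δ k := by
  have hIcc : Finset.Icc 1 k = Finset.Ico 1 (k + 1) := by
    ext t; simp only [Finset.mem_Icc, Finset.mem_Ico]; omega
  refine div_le_regretBound Fintype.card_pos Fintype.card_pos hH hk hδ hδ1 ?_ ?_
  · calc _ ≤ ∑ t ∈ Finset.Icc 1 k, (H : ℝ) :=
        Finset.sum_le_sum fun t ht => hxH t (Finset.mem_Icc.mp ht).1
      _ = k * H := by simp
  · calc _ ≤ ∑ t ∈ Finset.Icc 1 k,
          10 * (H : ℝ) ^ 2 * expTotal H s₀ (π t ω) M.p (uncertainty H δ O t ω) :=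
          Finset.sum_le_sum fun t ht => hx t (Finset.mem_Icc.mp ht).1
      _ ≤ _ := by
          rw [← Finset.mul_sum, hIcc]
          refine mul_le_mul_of_nonneg_left (hgood.total.le.trans ?_) (by positivity)
          have := sum_uncertainty_le hH hδ O k ω
          linarith

/-- On the event that all estimates are accurate, the regret bounds hold. -/
theorem regret_le_of_accurateEstimates [Nonempty S] [Nonempty A] (hM : M.IsProper)
    (hstar : IsOptimal H s₀ ξ M πstar) (hpol : ∀ t, 1 ≤ t → IsPolicy H (π t ω)) (hH : 1 ≤ H)
    (hδ : 0 < δ) (hδ1 : δ ≤ 1 / 3) (hchosen : ChosenByConRL H s₀ ξ δ O π)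
    (hgood : ∀ k, 1 ≤ k → AccurateEstimates H s₀ δ M πstar π O k ω) (hω : BoundedOutcomes H O ω)
    (hk : 1 ≤ k) :
    rewReg H s₀ M πstar (fun t => π t ω) k ≤
        regretBound 1000 (Fintype.card S) (Fintype.card A) (Fintype.card ι) H δ k ∧
      consReg H s₀ ξ M (fun t => π t ω) k ≤
        regretBound 1000 (Fintype.card S) (Fintype.card A) (Fintype.card ι) H δ k := by
  have hS : 1 ≤ Fintype.card S := Fintype.card_pos
  have hA : 1 ≤ Fintype.card A := Fintype.card_pos
  have hk0 : (0 : ℝ) < k := by exact_mod_cast hk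
  have hL : ∀ t, 1 ≤ t → 1 ≤ logBonus S A ι H δ t := fun t ht =>
    one_le_logTerm hS hA hH ht hδ (by linarith)
  have hopt := fun t (ht : 1 ≤ t) =>
    chosen_policy_optimistic hM hstar ht (hL t ht) hchosen (hgood t ht) hω
  have hsim := fun t (ht : 1 ≤ t) o => abs_le.mp (abs_expTotal_sub_bonusModel_le (s₀ := s₀) hM
    hstar.1.1 hH hS (hL t ht) (hpol t ht) (hgood t ht) hω o)
  have htot := fun π' (hπ' : IsPolicy H π') o =>
    expTotal_mem_Icc (s₀ := s₀) hπ' hM.p_mem (hM.mean_mem o)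
  have hconst : ∀ y : ℝ, 1 / (k : ℝ) * ∑ _t ∈ Finset.Icc 1 k, y = y := fun y => by
    simp; field_simp
  constructor
  · have := mean_le_regretBound hH hδ hδ1 hk (hgood k hk)
      (fun t => expTotal H s₀ πstar M.p M.r - expTotal H s₀ (π t ω) M.p M.r)
      (fun t ht => by
        have h1 := htot _ hstar.1.1 none
        have h2 := htot _ (hpol t ht) none
        change expTotal H s₀ πstar M.p (M.mean none) -
          expTotal H s₀ (π t ω) M.p (M.mean none) ≤ H
        linarith [h1.2, h2.1])
      (fun t ht => by
        have h1 := (hopt t ht).2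
        have h2 := (hsim t ht none).1
        change -_ ≤ expTotal H s₀ (π t ω) M.p M.r - expTotal H s₀ (π t ω)
          (bonusModel H δ O t ω).p (bonusModel H δ O t ω).r at h2
        linarith)
    rw [Finset.sum_sub_distrib, mul_sub, hconst] at this
    exact this
  · refine Real.iSup_le (fun i => ?_) (regretBound_nonneg (by norm_num) _ _ _ _ _ _)
    -- Feasibility of `πstar` forces nonnegative capacities, so the excess of an episode is at most
    -- `H`.
    have hξ : 0 ≤ ξ i := (htot _ hstar.1.1 (some i)).1.trans (hstar.1.2 i)
    have := mean_le_regretBound hH hδ hδ1 hk (hgood k hk)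
      (fun t => expTotal H s₀ (π t ω) M.p (fun s a => M.c s a i) - ξ i)
      (fun t ht => by
        have h2 := (htot _ (hpol t ht) (some i)).2
        change expTotal H s₀ (π t ω) M.p (fun s a => M.c s a i) ≤ H at h2
        linarith)
      (fun t ht => by
        have h1 := (hopt t ht).1.2 i
        have h2 := (hsim t ht (some i)).2
        change expTotal H s₀ (π t ω) M.p (fun s a => M.c s a i) - expTotal H s₀ (π t ω)
          (bonusModel H δ O t ω).p (fun s a => (bonusModel H δ O t ω).c s a i) ≤ _ at h2
        linarith)
    rw [Finset.sum_sub_distrib, mul_sub, hconst] at this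
    exact this

end GoodEvent

/-! ### The theorem. -/

theorem theorem1 :
    ∃ c : ℝ, 0 < c ∧
      ∀ (S A ι Ω : Type*) [Fintype S] [DecidableEq S] [Fintype A] [DecidableEq A] [Fintype ι]
        [mΩ : MeasurableSpace Ω] (μ : Measure Ω) [IsProbabilityMeasure μ] (ℱ : Filtration ℕ mΩ)
        (H : ℕ) (s₀ : S) (ξ : ι → ℝ) (δ : ℝ) (M : CMDP S A ι) (πstar : Policy S A)
        (O : Observations S A ι Ω) (π : ℕ → Ω → Policy S A),
        0 < δ → M.IsProper → IsOptimal H s₀ ξ M πstar →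
        FollowsProtocol μ ℱ H s₀ M π O → ChosenByConRL H s₀ ξ δ O π →
        ENNReal.ofReal (1 - 3 * δ) ≤
          μ {ω | ∀ k : ℕ, 1 ≤ k →
            rewReg H s₀ M πstar (fun t => π t ω) k ≤
                regretBound c (Fintype.card S) (Fintype.card A) (Fintype.card ι) H δ k ∧
              consReg H s₀ ξ M (fun t => π t ω) k ≤
                regretBound c (Fintype.card S) (Fintype.card A) (Fintype.card ι) H δ k} := by
  refine ⟨1000, by norm_num, ?_⟩
  intro S A ι Ω _ _ _ _ _ mΩ μ _ ℱ H s₀ ξ δ M πstar O π hδ hM hstar hFP hchosen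
  -- For `H = 0` all totals vanish, and feasibility of `πstar` makes the capacities nonnegative, so
  -- neither regret is positive.
  rcases Nat.eq_zero_or_pos H with rfl | hH
  · have hξ : ∀ i, 0 ≤ ξ i := fun i => by simpa [expTotal] using hstar.1.2 i
    have huniv : {ω | ∀ k : ℕ, 1 ≤ k →
        rewReg 0 s₀ M πstar (fun t => π t ω) k ≤
            regretBound 1000 (Fintype.card S) (Fintype.card A) (Fintype.card ι) 0 δ k ∧
          consReg 0 s₀ ξ M (fun t => π t ω) k ≤
            regretBound 1000 (Fintype.card S) (Fintype.card A) (Fintype.card ι) 0 δ k} =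
        Set.univ := by
      refine Set.eq_univ_of_forall fun ω k _ => ?_
      have hb := regretBound_nonneg (c := 1000) (by norm_num) (Fintype.card S) (Fintype.card A)
        (Fintype.card ι) 0 δ k
      refine ⟨le_trans (by simp [rewReg, expTotal]) hb, Real.iSup_le (fun i => ?_) hb⟩
      refine le_trans ?_ hb
      simpa [expTotal] using hξ i
    rw [huniv, measure_univ]
    exact ENNReal.ofReal_le_one.mpr (by linarith)
  -- For `δ > 1/3` the claimed probability is negative and its `ENNReal.ofReal` is `0`.
  by_cases hδ1 : δ ≤ 1 / 3
  swap
  · rw [ENNReal.ofReal_of_nonpos (by linarith)]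
    exact zero_le
  have : Nonempty S := ⟨s₀⟩
  have : Nonempty A := by
    by_contra hA
    rw [not_nonempty_iff] at hA
    have := (hstar.1.1 0 hH s₀).2
    simp at this
  set G := {ω | ∀ k : ℕ, 1 ≤ k →
    rewReg H s₀ M πstar (fun t => π t ω) k ≤
        regretBound 1000 (Fintype.card S) (Fintype.card A) (Fintype.card ι) H δ k ∧
      consReg H s₀ ξ M (fun t => π t ω) k ≤
        regretBound 1000 (Fintype.card S) (Fintype.card A) (Fintype.card ι) H δ k} with hG
  have hGc : μ Gᶜ ≤ ENNReal.ofReal (3 * δ) := by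
    have hsub : Gᶜ ⊆ {ω | ∃ k, 1 ≤ k ∧ ¬ AccurateEstimates H s₀ δ M πstar π O k ω} ∪
        {ω | ¬ BoundedOutcomes H O ω} := by
      intro ω hω
      by_contra hcon
      rw [Set.mem_union, not_or] at hcon
      obtain ⟨h1, h2⟩ := hcon
      refine hω fun k hk => regret_le_of_accurateEstimates hM hstar
        (fun t ht => hFP.isPolicy t ht ω) hH hδ hδ1 hchosen (fun t ht => ?_) (not_not.mp h2) hk
      by_contra hbad
      exact h1 ⟨t, ht, hbad⟩
    refine (measure_mono hsub).trans ((measure_union_le _ _).trans ?_)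
    rw [ae_iff.mp (ae_boundedOutcomes hFP), add_zero]
    exact measure_exists_not_accurateEstimates_le hM hFP hstar.1.1 hH hδ (by linarith)
  -- Subadditivity is enough here and avoids showing that `G` is measurable.
  have hone : (1 : ENNReal) ≤ μ G + μ Gᶜ := by
    rw [← measure_univ (μ := μ), ← Set.union_compl_self G]
    exact measure_union_le _ _
  rw [ENNReal.ofReal_sub _ (by positivity), ENNReal.ofReal_one]
  exact tsub_le_iff_right.mpr (hone.trans (add_le_add_right hGc _))
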